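/- Notation. Let $G=(\{1,\dots,p\},E)$ be an undirected graph. Let $\mathcal S_p^+$ be the set of real symmetric positive definite $p\times p$ matrices and $\mathcal S_p^+(G)$ the set of $A\in\mathcal S_p^+$ with $A_{i,j}=0$ whenever $i\ne j$ and $\{i,j\}\notin E$. For $A\in\mathcal S_p^+$ let $h_G(A)$ be the unique $B\in\mathcal S_p^+$ with $B_{i,j}=A_{i,j}$ if $i=j$ or $\{i,j\}\in E$, and $(B^{-1})_{i,j}=0$ if $i\neq j$ and $\{i,j\}\notin E$ (existence and uniqueness are part of the claim); for a matrix $A\notin\mathcal S_p^+$ put $h_G(A)=0$. Let $\operatorname{vec}A\in\mathbb R^{p^2}$ be the vector of the stacked columns of $A$, with inverse operation $\operatorname{mat}$, let $\otimes$ be the Kronecker product, $K_p=\sum_{i,j}e_ie_j^T\otimes e_je_i^T$ and $M_p=\tfrac12(I_{p^2}+K_p)$. Let $m=p(p+1)/2$, let $D_p\in\mathbb R^{p^2\times m}$ be the duplication matrix, which maps the vector of the entries on and below the diagonal of a symmetric matrix $A$ (in the order of $\operatorname{vec}A$) to $\operatorname{vec}A$, and let $D_p^+=(D_p^TD_p)^{-1}D_p^T$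 and $v(A)=D_p^+\operatorname{vec}A$. For a function $h$ of symmetric matrices with symmetric values put $\tilde h(x)=v\{h(\operatorname{mat}(D_px))\}$, $x\in\mathbb R^m$, and $\mathbb D h(A)=D_p\,\mathbb D\tilde h(v(A))\,D_p^+$, where $\mathbb D\tilde h$ is the Jacobi matrix. Let $D(G)=\{(i,j):j<i,\ \{i,j\}\notin E\}$ and $K(G)=\{(i,j):j<i,\ \{i,j\}\in E\}\cup\{(i,i):1\le i\le p\}$, of sizes $q$ and $m-q$, and let $Q_D$ and $Q_K$ be the $0$-$1$ matrices such that $Q_D\operatorname{vec}A$ and $Q_K\operatorname{vec}A$ consist of the entries of $A$ at the positions in $D(G)$ and in $K(G)$, in the order of $\operatorname{vec}A$. Let $\tilde Q_K=Q_KD_p$. Theorem. Let $V\in\mathcal S_p^+$ and let $(\hat V_n)_{n\in\mathbb N}$ be a sequence of random $p\times p$ matrices, symmetric with probability tending to $1$, such that $\sqrt n\operatorname{vec}(\hat V_n-V)$ converges in distribution to an $\mathbb R^{p^2}$-valued random vector $Z$. Write $V_G=h_G(V)$. Then $\tilde h_G$ is differentiable at $v(V)$, the matrix $Q_DM_p(V_G^{-1}\otimes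 V_G^{-1})Q_D^T$ is invertible, and $$\mathbb Dh_G(V)=M_p-M_pQ_D^T\{Q_DM_p(V_G^{-1}\otimes V_G^{-1})Q_D^T\}^{-1}Q_D(V_G^{-1}\otimes V_G^{-1})M_p .$$ (I) $\sqrt n\operatorname{vec}\{h_G(\hat V_n)-h_G(V)\}\to\mathbb Dh_G(V)Z$ in distribution. (II) If moreover $Z$ is normal with mean zero and covariance matrix $W_V=2\sigma_1M_p(V\otimes V)+\sigma_2\operatorname{vec}V(\operatorname{vec}V)^T$ for some scalars $\sigma_1\ge0$ and $\sigma_2\ge-2\sigma_1/p$, then $\mathbb Dh_G(V)Z$ is normal with mean zero and (positive semidefinite) covariance matrix $$W_{V,G}=2\sigma_1\,\mathbb Dh_G(V)(V\otimes V)\{\mathbb Dh_G(V)\}^T+\sigma_2\operatorname{vec}V_G(\operatorname{vec}V_G)^T .$$ (III) $V^{-1}\in\mathcal S_p^+(G)$ holds if and only if $V=h_G(V)$. In this case, under the assumptions of (II), the inverse below exists and $$W_{V,G}=2\sigma_1M_p\left[V\otimes V-Q_D^T\{Q_DM_p(V^{-1}\otimes V^{-1})Q_D^T\}^{-1}Q_DM_p\right]+\sigma_2\operatorname{vec}V(\operatorname{vec}V)^T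 .$$ (IV) Let $u=Q_K\operatorname{vec}(V^{-1})$ and $\hat u_G=Q_K\operatorname{vec}\{h_G(\hat V_n)^{-1}\}$ (with the inverse of a singular matrix read as $0$). Under the assumptions of (III), $\sqrt n(\hat u_G-u)\to N_{m-q}(0,W_{u,G})$ in distribution, where $$W_{u,G}=2\sigma_1\{\tilde Q_KD_p^T(V\otimes V)D_p\tilde Q_K^T\}^{-1}+\sigma_2uu^T ;$$ the inverse exists and $W_{u,G}$ is positive semidefinite. -/

import Mathlib

open MeasureTheory ProbabilityTheory Filter
open scoped Matrix Kronecker Topology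

noncomputable section

namespace EllGraph

/-- Coordinates of `ℝ^(p²)`. `Matrix.vec A` has the entry `A i j` at the coordinate `(j, i)`;
in lexicographic order these coordinates list the columns of `A` from left to right, and Mathlib's
Kronecker product `A ⊗ₖ B` has `A i j * B k l` at row `(i, k)` and column `(j, l)`. -/
abbrev Coord (p : ℕ) : Type := Fin p × Fin p

/-- The positions `(i, j)` on or below the diagonal of a `p × p` matrix, `j ≤ i`:
the coordinates of `ℝ^m`, `m = p (p + 1) / 2`. -/
abbrev LowerPos (p : ℕ) : Type := {z : Fin p × Fin p // z.2 ≤ z.1}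

/-- `vec A` as a vector of the Euclidean space `ℝ^(p²)`. -/
def evec {p : ℕ} (A : Matrix (Fin p) (Fin p) ℝ) : EuclideanSpace ℝ (Coord p) :=
  WithLp.toLp 2 (Matrix.vec A)

/-- The inverse of the operator `vec`. -/
def mat {p : ℕ} (a : Coord p → ℝ) : Matrix (Fin p) (Fin p) ℝ :=
  Matrix.of fun i j => a (j, i)

/-- The action of a real matrix on column vectors, between Euclidean spaces. -/
def act {ι κ : Type*} [Fintype κ] (A : Matrix ι κ ℝ) (x : EuclideanSpace ℝ κ) :
    EuclideanSpace ℝ ι :=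
  WithLp.toLp 2 (A *ᵥ x.ofLp)

/-- The commutation matrix `K_p = ∑ i j, e_i e_jᵀ ⊗ e_j e_iᵀ`. -/
def commMat (p : ℕ) : Matrix (Coord p) (Coord p) ℝ :=
  ∑ i : Fin p, ∑ j : Fin p, Matrix.single i j (1 : ℝ) ⊗ₖ Matrix.single j i (1 : ℝ)

/-- The symmetrization matrix `M_p = (I + K_p) / 2`. -/
def symMat (p : ℕ) : Matrix (Coord p) (Coord p) ℝ :=
  (1 / 2 : ℝ) • (1 + commMat p)

/-- The duplication matrix `D_p`, which maps `v(A)` to `vec A` for symmetric `A`: the coordinate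
`(j, i)` of `vec A` is read off at the position `(max i j, min i j)`. -/
def dupMat (p : ℕ) : Matrix (Coord p) (LowerPos p) ℝ :=
  Matrix.of fun c z => if z.1 = (max c.2 c.1, min c.2 c.1) then 1 else 0

/-- The Moore-Penrose inverse `D_p⁺ = (D_pᵀ D_p)⁻¹ D_pᵀ` of the duplication matrix. -/
def dupPinv (p : ℕ) : Matrix (LowerPos p) (Coord p) ℝ :=
  ((dupMat p)ᵀ * dupMat p)⁻¹ * (dupMat p)ᵀ

/-- The selection matrix `Q_Z` of a set `Z` of matrix positions: the row that belongs to the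
position `(i, j) ∈ Z` has its only entry `1` at the coordinate `(j, i)` of `vec`. -/
def selMat {p : ℕ} (S : Finset (Fin p × Fin p)) : Matrix S (Coord p) ℝ :=
  Matrix.of fun z c => if c = (z.1.2, z.1.1) then 1 else 0

/-- `D(G)`: the sub-diagonal positions that are not edges of `G`. -/
def nonEdgePos {p : ℕ} (G : SimpleGraph (Fin p)) [DecidableRel G.Adj] : Finset (Fin p × Fin p) :=
  Finset.univ.filter fun z => z.2 < z.1 ∧ ¬ G.Adj z.1 z.2

/-- `K(G)`: the diagonal positions and the sub-diagonal positions that are edges of `G`. -/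
def edgePos {p : ℕ} (G : SimpleGraph (Fin p)) [DecidableRel G.Adj] : Finset (Fin p × Fin p) :=
  Finset.univ.filter fun z => (z.2 < z.1 ∧ G.Adj z.1 z.2) ∨ z.1 = z.2

/-- `Q_D`. -/
abbrev QD {p : ℕ} (G : SimpleGraph (Fin p)) [DecidableRel G.Adj] :
    Matrix (nonEdgePos G) (Coord p) ℝ :=
  selMat (nonEdgePos G)

/-- `Q_K`. -/
abbrev QK {p : ℕ} (G : SimpleGraph (Fin p)) [DecidableRel G.Adj] :
    Matrix (edgePos G) (Coord p) ℝ :=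
  selMat (edgePos G)

/-- `Q̃_K = Q_K D_p`. -/
def QKt {p : ℕ} (G : SimpleGraph (Fin p)) [DecidableRel G.Adj] :
    Matrix (edgePos G) (LowerPos p) ℝ :=
  QK G * dupMat p

/-- `S_p⁺(G)`: the positive definite matrices with zeros at the off-diagonal non-edges of `G`. -/
def concSet {p : ℕ} (G : SimpleGraph (Fin p)) : Set (Matrix (Fin p) (Fin p) ℝ) :=
  {A | A.PosDef ∧ ∀ i j, i ≠ j → ¬ G.Adj i j → A i j = 0}

/-- `B` is a positive definite solution of the system that defines `h_G(A)`. -/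
def IsConstrained {p : ℕ} (G : SimpleGraph (Fin p)) (A B : Matrix (Fin p) (Fin p) ℝ) : Prop :=
  B.PosDef ∧ (∀ i j, G.Adj i j ∨ i = j → B i j = A i j) ∧
    ∀ i j, ¬ G.Adj i j → i ≠ j → B⁻¹ i j = 0

open Classical in
/-- The function `h_G : S_p⁺ → S_p⁺`, which maps `A` to the positive definite solution of the
system above; outside `S_p⁺` it gets the value `0`. -/
def hG {p : ℕ} (G : SimpleGraph (Fin p)) (A : Matrix (Fin p) (Fin p) ℝ) :
    Matrix (Fin p) (Fin p) ℝ :=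
  if h : A.PosDef ∧ ∃ B, IsConstrained G A B then h.2.choose else 0

/-- `v(A) = D_p⁺ vec A`. -/
def vech {p : ℕ} (A : Matrix (Fin p) (Fin p) ℝ) : LowerPos p → ℝ :=
  dupPinv p *ᵥ Matrix.vec A

/-- `h̃`, the function of `v(A)` with values `v(h(A))` that corresponds to a function `h` of
symmetric matrices; here `v⁻¹(x) = mat (D_p x)`. -/
def tildeFun {p : ℕ} (h : Matrix (Fin p) (Fin p) ℝ → Matrix (Fin p) (Fin p) ℝ)
    (x : LowerPos p → ℝ) : LowerPos p → ℝ :=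
  vech (h (mat (dupMat p *ᵥ x)))

/-- The derivative of a function `h` between symmetric matrices at `A`, as the `p² × p²` matrix
`D_p J D_p⁺`, where `J` is the Jacobi matrix of `h̃` at `v(A)`. -/
def derivMat {p : ℕ} (h : Matrix (Fin p) (Fin p) ℝ → Matrix (Fin p) (Fin p) ℝ)
    (A : Matrix (Fin p) (Fin p) ℝ) : Matrix (Coord p) (Coord p) ℝ :=
  dupMat p * LinearMap.toMatrix' (fderiv ℝ (tildeFun h) (vech A)).toLinearMap * dupPinv p

/-- `(vec A) (vec A)ᵀ`. -/
def vecOuter {p : ℕ} (A : Matrix (Fin p) (Fin p) ℝ) : Matrix (Coord p) (Coord p) ℝ :=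
  Matrix.vecMulVec (Matrix.vec A) (Matrix.vec A)

/-- `W_V = 2 σ₁ M_p (V ⊗ V) + σ₂ vec V (vec V)ᵀ`. -/
def WV {p : ℕ} (s₁ s₂ : ℝ) (V : Matrix (Fin p) (Fin p) ℝ) : Matrix (Coord p) (Coord p) ℝ :=
  (2 * s₁) • (symMat p * (V ⊗ₖ V)) + s₂ • vecOuter V

/-- `W_{V,G} = 2 σ₁ Dh_G(V) (V ⊗ V) Dh_G(V)ᵀ + σ₂ vec V_G (vec V_G)ᵀ` with `V_G = h_G(V)`. -/
def WVG {p : ℕ} (G : SimpleGraph (Fin p)) (s₁ s₂ : ℝ) (V : Matrix (Fin p) (Fin p) ℝ) :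
    Matrix (Coord p) (Coord p) ℝ :=
  (2 * s₁) • (derivMat (hG G) V * (V ⊗ₖ V) * (derivMat (hG G) V)ᵀ) + s₂ • vecOuter (hG G V)

/-- `Q_D M_p (A⁻¹ ⊗ A⁻¹) Q_Dᵀ`. -/
def coreD {p : ℕ} (G : SimpleGraph (Fin p)) [DecidableRel G.Adj]
    (A : Matrix (Fin p) (Fin p) ℝ) : Matrix (nonEdgePos G) (nonEdgePos G) ℝ :=
  QD G * symMat p * (A⁻¹ ⊗ₖ A⁻¹) * (QD G)ᵀ

/-- `Q̃_K D_pᵀ (V ⊗ V) D_p Q̃_Kᵀ`. -/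
def coreK {p : ℕ} (G : SimpleGraph (Fin p)) [DecidableRel G.Adj]
    (V : Matrix (Fin p) (Fin p) ℝ) : Matrix (edgePos G) (edgePos G) ℝ :=
  QKt G * (dupMat p)ᵀ * (V ⊗ₖ V) * dupMat p * (QKt G)ᵀ

/-- `Q_K vec A`: the entries of `A` at the positions in `K(G)`. -/
def uVec {p : ℕ} (G : SimpleGraph (Fin p)) [DecidableRel G.Adj]
    (A : Matrix (Fin p) (Fin p) ℝ) : EuclideanSpace ℝ (edgePos G) :=
  act (QK G) (evec A)

/-- `W_{u,G} = 2 σ₁ {Q̃_K D_pᵀ (V ⊗ V) D_p Q̃_Kᵀ}⁻¹ + σ₂ u uᵀ` with `u = Q_K vec (V⁻¹)`. -/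
def WuG {p : ℕ} (G : SimpleGraph (Fin p)) [DecidableRel G.Adj] (s₁ s₂ : ℝ)
    (V : Matrix (Fin p) (Fin p) ℝ) : Matrix (edgePos G) (edgePos G) ℝ :=
  (2 * s₁) • (coreK G V)⁻¹ + s₂ • Matrix.vecMulVec (uVec G V⁻¹).ofLp (uVec G V⁻¹).ofLp

end EllGraph

end

/-! Write B = h_G(V), W = B⁻¹ ⊗ B⁻¹, and call the diagonal and edge entries of a matrix kept. B
exists because the positive semidefinite completions of the kept entries of V form a compact set,
and stationarity of a determinant maximizer says exactly that B⁻¹ vanishes at the non-edges.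
Everything rigid rests on `eq_zero_of_disjoint_support`: for positive definite P and Q, the form
tr(Xᵀ P X Q) is positive unless X = 0. It gives uniqueness of B and injectivity of the linearized
system.

Hence `constraintMap` (kept entries of a matrix, other entries of its inverse) has an invertible
derivative at B, and near V, on symmetric matrices, h_G is its local inverse after the projection to
kept entries. The derivative T at V sends a symmetric X to the Y that has the kept entries of X and
for which B⁻¹ Y B⁻¹ vanishes elsewhere; `derivFormula` has both properties, so it is T. A delta
method relative to the closed set of symmetric matrices gives the limit laws.

The covariances are then algebra. T maps vec V to vec B. If V = B, then T is a projection and T(V ⊗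
V) is symmetric, so T(V ⊗ V)Tᵀ = T(V ⊗ V). For the concentration entries, `inv_coreK_mul` exhibits
Q_K W T Q_Kᵀ as the inverse of `coreK`. -/

noncomputable section

namespace EllGraph

variable {p : ℕ}

/-! ### Symmetrization, duplication and selection matrices -/

theorem vec_mat (a : Coord p → ℝ) : Matrix.vec (mat a) = a := rfl

/-- Every vector is some vec X, so identities between p² × p² matrices become identities about X,
where Kronecker products turn into ordinary products. -/
theorem ext_mulVec_vec {ι : Type*} {A B : Matrix ι (Coord p) ℝ}
    (h : ∀ X : Matrix (Fin p) (Fin p) ℝ, A *ᵥ Matrix.vec X = B *ᵥ Matrix.vec X) : A = B :=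
  Matrix.ext_of_mulVec_single fun c => by
    have := h (mat (Pi.single c 1))
    rwa [vec_mat] at this

theorem commMat_mulVec_vec (A : Matrix (Fin p) (Fin p) ℝ) :
    commMat p *ᵥ Matrix.vec A = Matrix.vec Aᵀ := by
  have h : commMat p *ᵥ Matrix.vec A =
      ∑ i : Fin p, ∑ j : Fin p, Matrix.vec (Matrix.single j i (A i j)) := by
    simp only [commMat, Matrix.sum_mulVec, Matrix.kronecker_mulVec_vec, Matrix.transpose_single]
    refine Finset.sum_congr rfl fun i _ => Finset.sum_congr rfl fun j _ => ?_
    congr 1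
    rw [Matrix.single_mul_mul_single]
    simp
  rw [h]
  ext ⟨a, b⟩
  simp [Finset.sum_apply, Pi.single_apply, ite_and]

theorem symMat_mulVec_vec (A : Matrix (Fin p) (Fin p) ℝ) :
    symMat p *ᵥ Matrix.vec A = Matrix.vec ((1 / 2 : ℝ) • (A + Aᵀ)) := by
  rw [symMat, Matrix.smul_mulVec, Matrix.add_mulVec, Matrix.one_mulVec, commMat_mulVec_vec]
  rfl

theorem symMat_mulVec_vec_of_isSymm {A : Matrix (Fin p) (Fin p) ℝ} (hA : A.IsSymm) :
    symMat p *ᵥ Matrix.vec A = Matrix.vec A := by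
  rw [symMat_mulVec_vec, hA.eq, ← two_smul ℝ A, smul_smul]
  norm_num

theorem isSymm_half_add_transpose (A : Matrix (Fin p) (Fin p) ℝ) :
    ((1 / 2 : ℝ) • (A + Aᵀ)).IsSymm := by
  simp [Matrix.IsSymm, add_comm]

theorem transpose_commMat : (commMat p)ᵀ = commMat p := by
  simp only [commMat, Matrix.transpose_sum, ← Matrix.kroneckerMap_transpose,
    Matrix.transpose_single]
  exact Finset.sum_comm

theorem transpose_symMat : (symMat p)ᵀ = symMat p := by
  simp [symMat, transpose_commMat]

theorem symMat_mul_symMat : symMat p * symMat p = symMat p := by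
  refine ext_mulVec_vec fun X => ?_
  rw [← Matrix.mulVec_mulVec, symMat_mulVec_vec,
    symMat_mulVec_vec_of_isSymm (isSymm_half_add_transpose X)]

theorem symMat_mul_kronecker (A : Matrix (Fin p) (Fin p) ℝ) :
    symMat p * (A ⊗ₖ A) = (A ⊗ₖ A) * symMat p := by
  refine ext_mulVec_vec fun X => ?_
  rw [← Matrix.mulVec_mulVec, ← Matrix.mulVec_mulVec, symMat_mulVec_vec,
    Matrix.kronecker_mulVec_vec, Matrix.kronecker_mulVec_vec, symMat_mulVec_vec]
  congr 1
  simp [Matrix.mul_add, Matrix.add_mul, Matrix.mul_assoc]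

theorem dupMat_mulVec_apply (x : LowerPos p → ℝ) (c : Coord p) :
    (dupMat p *ᵥ x) c = x ⟨(max c.2 c.1, min c.2 c.1), min_le_max⟩ := by
  rw [Matrix.mulVec, dotProduct, Finset.sum_eq_single ⟨(max c.2 c.1, min c.2 c.1), min_le_max⟩]
  · simp [dupMat]
  · rintro z - hz
    have : z.1 ≠ (max c.2 c.1, min c.2 c.1) := fun h => hz (Subtype.ext h)
    simp [dupMat, this]
  · simp

theorem isSymm_mat_dupMat_mulVec (x : LowerPos p → ℝ) : (mat (dupMat p *ᵥ x)).IsSymm := by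
  ext i j
  simp only [Matrix.transpose_apply, mat, Matrix.of_apply, dupMat_mulVec_apply]
  simp only [max_comm, min_comm]

theorem exists_dupMat_mulVec_eq_vec {A : Matrix (Fin p) (Fin p) ℝ} (hA : A.IsSymm) :
    ∃ x, dupMat p *ᵥ x = Matrix.vec A := by
  refine ⟨fun z => A z.1.1 z.1.2, ?_⟩
  ext ⟨j, i⟩
  rw [dupMat_mulVec_apply]
  rcases le_total i j with h | h
  · simpa [h] using hA.apply i j
  · simp [h]

theorem dupMat_mulVec_injective : Function.Injective (dupMat p).mulVec := by
  intro x y h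
  ext ⟨⟨i, j⟩, hij⟩
  have := congrFun h (j, i)
  simpa [dupMat_mulVec_apply, max_eq_left hij, min_eq_right hij] using this

theorem dupPinv_mul_dupMat : dupPinv p * dupMat p = 1 := by
  have h : ((dupMat p)ᵀ * dupMat p).PosDef := by
    simpa using Matrix.PosDef.conjTranspose_mul_self (dupMat p) dupMat_mulVec_injective
  rw [dupPinv, Matrix.mul_assoc, Matrix.nonsing_inv_mul]
  exact (Matrix.isUnit_iff_isUnit_det _).1 h.isUnit

theorem symMat_mul_dupMat : symMat p * dupMat p = dupMat p := by
  refine Matrix.ext_of_mulVec_single fun z => ?_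
  rw [← Matrix.mulVec_mulVec, ← vec_mat (dupMat p *ᵥ _),
    symMat_mulVec_vec_of_isSymm (isSymm_mat_dupMat_mulVec _)]

theorem dupPinv_mul_symMat : dupPinv p * symMat p = dupPinv p := by
  have h := congrArg Matrix.transpose (symMat_mul_dupMat (p := p))
  rw [Matrix.transpose_mul, transpose_symMat] at h
  rw [dupPinv, Matrix.mul_assoc, h]

/-- D⁺ absorbs M_p on its right, and M_p vec X lies in the range of D_p, where D D⁺ is the identity.
-/
theorem dupMat_mul_dupPinv : dupMat p * dupPinv p = symMat p := by
  refine ext_mulVec_vec fun X => ?_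
  rw [← dupPinv_mul_symMat, ← Matrix.mul_assoc, ← Matrix.mulVec_mulVec, symMat_mulVec_vec]
  obtain ⟨x, hx⟩ := exists_dupMat_mulVec_eq_vec (isSymm_half_add_transpose X)
  rw [← hx, Matrix.mulVec_mulVec, Matrix.mul_assoc, dupPinv_mul_dupMat, Matrix.mul_one]

theorem dupMat_mulVec_vech {A : Matrix (Fin p) (Fin p) ℝ} (hA : A.IsSymm) :
    dupMat p *ᵥ vech A = Matrix.vec A := by
  rw [vech, Matrix.mulVec_mulVec, dupMat_mul_dupPinv, symMat_mulVec_vec_of_isSymm hA]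

theorem selMat_mulVec_vec (S : Finset (Fin p × Fin p)) (A : Matrix (Fin p) (Fin p) ℝ) (z : S) :
    (selMat S *ᵥ Matrix.vec A) z = A z.1.1 z.1.2 := by
  simp [selMat, Matrix.mulVec, dotProduct]

/-- The matrix with prescribed entries at the positions in `S` and zeros elsewhere. -/
def fill (S : Finset (Fin p × Fin p)) (x : S → ℝ) : Matrix (Fin p) (Fin p) ℝ :=
  Matrix.of fun i j => if h : (i, j) ∈ S then x ⟨(i, j), h⟩ else 0

theorem transpose_selMat_mulVec (S : Finset (Fin p × Fin p)) (x : S → ℝ) :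
    (selMat S)ᵀ *ᵥ x = Matrix.vec (fill S x) := by
  ext ⟨j, i⟩
  simp only [Matrix.mulVec, dotProduct, Matrix.transpose_apply, selMat, Matrix.of_apply, fill,
    Matrix.vec, ite_mul, one_mul, zero_mul]
  split_ifs with h
  · rw [Finset.sum_eq_single ⟨(i, j), h⟩]
    · simp
    · rintro ⟨⟨a, b⟩, hz⟩ - hne
      rw [if_neg]
      rintro h'
      simp only [Prod.mk.injEq] at h'
      exact hne (by simp [h'])
    · simp
  · refine Finset.sum_eq_zero fun z _ => if_neg ?_
    rintro h'
    simp only [Prod.mk.injEq] at h'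
    apply h
    have := z.2
    rwa [h'.1, h'.2]

/-! ### Existence and uniqueness of the constrained completion -/

theorem isHermitian_iff_isSymm {A : Matrix (Fin p) (Fin p) ℝ} : A.IsHermitian ↔ A.IsSymm := by
  rw [Matrix.IsHermitian, Matrix.IsSymm, Matrix.conjTranspose_eq_transpose_of_trivial]

/-- The not necessarily symmetric matrices with positive quadratic form. -/
def posForm (p : ℕ) : Set (Matrix (Fin p) (Fin p) ℝ) :=
  {A | ∀ x : Fin p → ℝ, x ≠ 0 → 0 < x ⬝ᵥ A *ᵥ x}

theorem posDef_iff_isSymm_and_mem_posForm {A : Matrix (Fin p) (Fin p) ℝ} :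
    A.PosDef ↔ A.IsSymm ∧ A ∈ posForm p := by
  rw [Matrix.posDef_iff_dotProduct_mulVec, isHermitian_iff_isSymm]
  simp [posForm]

/-- `PosDef` includes symmetry and so is not an open condition among all matrices; positivity of the
form is. The unit sphere is compact, and homogeneity carries the bound to all nonzero vectors. -/
theorem isOpen_posForm : IsOpen (posForm p) := by
  rw [isOpen_iff_mem_nhds]
  intro A hA
  have hK : IsCompact (Metric.sphere (0 : Fin p → ℝ) 1) := isCompact_sphere _ _
  have hcont : Continuous fun z : Matrix (Fin p) (Fin p) ℝ × (Fin p → ℝ) => z.2 ⬝ᵥ z.1 *ᵥ z.2 :=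
    continuous_snd.dotProduct (continuous_fst.matrix_mulVec continuous_snd)
  have key : ∀ᶠ B in 𝓝 A, ∀ x ∈ Metric.sphere (0 : Fin p → ℝ) 1, 0 < x ⬝ᵥ B *ᵥ x := by
    refine hK.eventually_forall_of_forall_eventually fun x hx => ?_
    refine hcont.continuousAt.eventually (lt_mem_nhds (hA x ?_))
    rintro rfl
    simp at hx
  filter_upwards [key] with B hB x hx
  have hx0 : 0 < ‖x‖ := norm_pos_iff.2 hx
  have h := hB (‖x‖⁻¹ • x) (by simp [norm_smul, hx0.ne'])
  rw [Matrix.mulVec_smul, dotProduct_smul, smul_dotProduct, smul_eq_mul, smul_eq_mul] at h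
  have h' : 0 < ‖x‖⁻¹ := inv_pos.2 hx0
  exact pos_of_mul_pos_right (pos_of_mul_pos_right h h'.le) h'.le

theorem dotProduct_kronecker_mulVec (P Q X : Matrix (Fin p) (Fin p) ℝ) :
    Matrix.vec X ⬝ᵥ (Q ⊗ₖ P) *ᵥ Matrix.vec X = ∑ i, ∑ j, X i j * (P * X * Qᵀ) i j := by
  rw [Matrix.kronecker_mulVec_vec, dotProduct, Fintype.sum_prod_type, Finset.sum_comm]
  rfl

/-- If `X` and `P X Q` have disjoint supports, where `P` and `Q` are positive definite,
then `X = 0`. -/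
theorem eq_zero_of_disjoint_support {P Q X : Matrix (Fin p) (Fin p) ℝ} (hP : P.PosDef)
    (hQ : Q.PosDef) (h : ∀ i j, X i j = 0 ∨ (P * X * Q) i j = 0) : X = 0 := by
  by_contra hX
  -- The form of Q ⊗ P at vec X is the sum of the products X i j · (P X Q) i j, all of which vanish.
  have hpos := (hQ.kronecker hP).dotProduct_mulVec_pos
    (x := Matrix.vec X) (by rwa [Ne, Matrix.vec_eq_zero_iff])
  rw [star_trivial, dotProduct_kronecker_mulVec, (isHermitian_iff_isSymm.1 hQ.1).eq] at hpos
  refine hpos.ne' (Finset.sum_eq_zero fun i _ => Finset.sum_eq_zero fun j _ => ?_)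
  rcases h i j with h | h <;> simp [h]

theorem isUnit_det_of_posDef {A : Matrix (Fin p) (Fin p) ℝ} (hA : A.PosDef) : IsUnit A.det :=
  (Matrix.isUnit_iff_isUnit_det _).1 hA.isUnit

/-- B − C vanishes at the kept positions, and B⁻¹(B − C)C⁻¹ = C⁻¹ − B⁻¹ vanishes at all others. -/
theorem IsConstrained.unique {G : SimpleGraph (Fin p)} {A B C : Matrix (Fin p) (Fin p) ℝ}
    (hB : IsConstrained G A B) (hC : IsConstrained G A C) : B = C := by
  have hB' := isUnit_det_of_posDef hB.1
  have hC' := isUnit_det_of_posDef hC.1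
  rw [← sub_eq_zero]
  refine eq_zero_of_disjoint_support hB.1.inv hC.1.inv fun i j => ?_
  by_cases hij : G.Adj i j ∨ i = j
  · left
    rw [Matrix.sub_apply, hB.2.1 i j hij, hC.2.1 i j hij, sub_self]
  · right
    push Not at hij
    rw [Matrix.mul_sub, Matrix.sub_mul, Matrix.nonsing_inv_mul _ hB', Matrix.mul_assoc,
      Matrix.mul_nonsing_inv _ hC', Matrix.one_mul, Matrix.mul_one, Matrix.sub_apply,
      hB.2.2 i j hij.1 hij.2, hC.2.2 i j hij.1 hij.2, sub_self]

/-- Test the form at e_i ± e_j. As completions share their diagonal, this bounds all their entries.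
-/
theorem abs_apply_le_of_posSemidef {B : Matrix (Fin p) (Fin p) ℝ} (hB : B.PosSemidef)
    (i j : Fin p) : |B i j| ≤ (B i i + B j j) / 2 := by
  have hs : B j i = B i j := (isHermitian_iff_isSymm.1 hB.1).apply i j
  have key : ∀ s : ℝ, 0 ≤ B i i + 2 * s * B i j + s ^ 2 * B j j := fun s => by
    have h := hB.dotProduct_mulVec_nonneg (Pi.single i 1 + s • Pi.single j 1)
    simp only [star_trivial, Matrix.mulVec_add, Matrix.mulVec_smul, add_dotProduct, dotProduct_add,
      smul_dotProduct, dotProduct_smul, Matrix.mulVec_single_one, single_one_dotProduct,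
      Matrix.col_apply, smul_eq_mul, hs] at h
    linarith
  rw [abs_le]
  constructor
  · linarith [key 1]
  · linarith [key (-1)]

theorem isClosed_posSemidef : IsClosed {B : Matrix (Fin p) (Fin p) ℝ | B.PosSemidef} := by
  simp only [Matrix.posSemidef_iff_dotProduct_mulVec, Set.ofPred_and, Set.ofPred_forall]
  refine IsClosed.inter ?_ (isClosed_iInter fun x => ?_)
  · exact isClosed_eq (continuous_id.matrix_conjTranspose) continuous_id
  · exact isClosed_le continuous_const
      (continuous_const.dotProduct (continuous_id.matrix_mulVec continuous_const))

/-- The positive semidefinite completions of the entries of `A` at the edges of `G` and on the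
diagonal. -/
def completions (G : SimpleGraph (Fin p)) (A : Matrix (Fin p) (Fin p) ℝ) :
    Set (Matrix (Fin p) (Fin p) ℝ) :=
  {B | B.PosSemidef ∧ ∀ i j, G.Adj i j ∨ i = j → B i j = A i j}

theorem isCompact_completions (G : SimpleGraph (Fin p)) (A : Matrix (Fin p) (Fin p) ℝ) :
    IsCompact (completions G A) := by
  have hbox : IsCompact (Set.pi Set.univ fun i => Set.pi Set.univ fun j =>
      Set.Icc (-((A i i + A j j) / 2)) ((A i i + A j j) / 2) : Set (Fin p → Fin p → ℝ)) :=
    isCompact_univ_pi fun i => isCompact_univ_pi fun j => isCompact_Icc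
  refine hbox.of_isClosed_subset ?_ ?_
  · have hset : completions G A = {B | B.PosSemidef} ∩
        ⋂ (i) (j) (_ : G.Adj i j ∨ i = j), {B | B i j = A i j} := by
      ext B
      simp [completions]
    rw [hset]
    refine IsClosed.inter isClosed_posSemidef ?_
    exact isClosed_iInter fun i => isClosed_iInter fun j => isClosed_iInter fun _ =>
      isClosed_eq (continuous_id.matrix_elem i j) continuous_const
  · rintro B ⟨hB, hBA⟩ i - j -
    have h := abs_apply_le_of_posSemidef hB i j
    rw [hBA i i (Or.inr rfl), hBA j j (Or.inr rfl)] at h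
    exact abs_le.1 h

/-- At a local maximum of the determinant along a line, the derivative vanishes. -/
theorem trace_inv_mul_eq_zero_of_isLocalMax {B E : Matrix (Fin p) (Fin p) ℝ} (hB : B.PosDef)
    (h : IsLocalMax (fun t : ℝ => (B + t • E).det) 0) : (B⁻¹ * E).trace = 0 := by
  have hu := isUnit_det_of_posDef hB
  -- det(B + tE) = det B · det(1 + t B⁻¹E), and the second factor is 1 + t tr(B⁻¹E) plus a
  -- polynomial multiple of t².
  have hf : (fun t : ℝ => (B + t • E).det) = fun t : ℝ => B.det * (1 + (B⁻¹ * E).trace * t +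
      (Matrix.det (1 + (Polynomial.X : Polynomial ℝ) •
        (B⁻¹ * E).map Polynomial.C)).divX.divX.eval t * t ^ 2) := by
    funext t
    rw [← Matrix.det_one_add_smul, ← Matrix.det_mul, Matrix.mul_add, Matrix.mul_one,
      Matrix.mul_smul, ← Matrix.mul_assoc, Matrix.mul_nonsing_inv _ hu, Matrix.one_mul]
  rw [hf] at h
  set q := (Matrix.det (1 + (Polynomial.X : Polynomial ℝ) •
        (B⁻¹ * E).map Polynomial.C)).divX.divX
  have hd := h.hasDerivAt_eq_zero ((((hasDerivAt_id (0 : ℝ)).const_mul (B⁻¹ * E).trace).const_add 1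
    |>.add ((q.hasDerivAt 0).mul ((hasDerivAt_id (0 : ℝ)).pow 2))).const_mul B.det)
  simpa [hB.det_pos.ne'] using hd

/-- A completion of maximal determinant is nonsingular, since A itself competes. Moving it along E =
e_i e_jᵀ + e_j e_iᵀ at a non-edge leaves the kept entries alone, so 0 = tr(B⁻¹E) = 2 (B⁻¹) i j. -/
theorem exists_isConstrained (G : SimpleGraph (Fin p)) {A : Matrix (Fin p) (Fin p) ℝ}
    (hA : A.PosDef) : ∃ B, IsConstrained G A B := by
  obtain ⟨B, ⟨hB, hBA⟩, hmax⟩ := (isCompact_completions G A).exists_isMaxOn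
    ⟨A, hA.posSemidef, fun _ _ _ => rfl⟩ (continuous_id.matrix_det).continuousOn
  have hdet : 0 < B.det := hA.det_pos.trans_le (hmax ⟨hA.posSemidef, fun _ _ _ => rfl⟩)
  have hpos : B.PosDef := hB.posDef_iff_det_ne_zero.2 hdet.ne'
  refine ⟨B, hpos, hBA, fun i j hadj hij => ?_⟩
  have hBs := isHermitian_iff_isSymm.1 hpos.1
  set E : Matrix (Fin p) (Fin p) ℝ := Matrix.single i j 1 + Matrix.single j i 1 with hE
  have hEs : E.IsSymm := by
    rw [Matrix.IsSymm, hE, Matrix.transpose_add, Matrix.transpose_single, Matrix.transpose_single,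
      add_comm]
  have hcont : Continuous fun t : ℝ => B + t • E :=
    continuous_const.add (continuous_id.smul continuous_const)
  have hloc : IsLocalMax (fun t : ℝ => (B + t • E).det) 0 := by
    -- Small perturbations remain positive definite, hence remain competitors.
    have hev : ∀ᶠ t : ℝ in 𝓝 0, B + t • E ∈ posForm p := by
      refine hcont.continuousAt.eventually (isOpen_posForm.mem_nhds ?_)
      simpa using (posDef_iff_isSymm_and_mem_posForm.1 hpos).2
    filter_upwards [hev] with t ht
    have hmem : B + t • E ∈ completions G A := by
      refine ⟨(posDef_iff_isSymm_and_mem_posForm.2 ⟨hBs.add (hEs.smul t), ht⟩).posSemidef,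
        fun k l hkl => ?_⟩
      have h0 : E k l = 0 := by
        have h1 : ¬ (i = k ∧ j = l) := by
          rintro ⟨rfl, rfl⟩
          exact hkl.elim hadj hij
        have h2 : ¬ (j = k ∧ i = l) := by
          rintro ⟨rfl, rfl⟩
          exact hkl.elim (fun h => hadj h.symm) (fun h => hij h.symm)
        simp [hE, h1, h2]
      simp [h0, hBA k l hkl]
    simpa using hmax hmem
  have htr := trace_inv_mul_eq_zero_of_isLocalMax hpos hloc
  have hinv : (B⁻¹) j i = B⁻¹ i j := (isHermitian_iff_isSymm.1 hpos.inv.1).apply i j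
  rw [hE, Matrix.mul_add, Matrix.trace_add, Matrix.trace_mul_single, Matrix.trace_mul_single,
    hinv] at htr
  simpa using htr

theorem isConstrained_hG (G : SimpleGraph (Fin p)) {A : Matrix (Fin p) (Fin p) ℝ}
    (hA : A.PosDef) : IsConstrained G A (hG G A) := by
  have h : A.PosDef ∧ ∃ B, IsConstrained G A B := ⟨hA, exists_isConstrained G hA⟩
  rw [hG, dif_pos h]
  exact h.2.choose_spec

theorem hG_of_not_posDef (G : SimpleGraph (Fin p)) {A : Matrix (Fin p) (Fin p) ℝ}
    (hA : ¬ A.PosDef) : hG G A = 0 :=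
  dif_neg fun h => hA h.1

theorem IsConstrained.hG_eq {G : SimpleGraph (Fin p)} {A B : Matrix (Fin p) (Fin p) ℝ}
    (hA : A.PosDef) (hB : IsConstrained G A B) : hG G A = B :=
  (isConstrained_hG G hA).unique hB

theorem inv_mem_concSet_iff (G : SimpleGraph (Fin p)) {V : Matrix (Fin p) (Fin p) ℝ}
    (hV : V.PosDef) : V⁻¹ ∈ concSet G ↔ hG G V = V := by
  constructor
  · rintro ⟨-, h⟩
    exact IsConstrained.hG_eq hV ⟨hV, fun _ _ _ => rfl, fun i j h1 h2 => h i j h2 h1⟩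
  · intro h
    refine ⟨hV.inv, fun i j hij hadj => ?_⟩
    have := (isConstrained_hG G hV).2.2 i j hadj hij
    rwa [h] at this

/-! ### Matrices as continuous linear maps; the derivative of inversion -/

/-- The continuous linear map of a matrix between Euclidean spaces. -/
def actL {ι κ : Type*} [Fintype ι] [Fintype κ] (A : Matrix ι κ ℝ) :
    EuclideanSpace ℝ κ →L[ℝ] EuclideanSpace ℝ ι :=
  LinearMap.toContinuousLinearMap
    { toFun := act A
      map_add' := fun x y => by simp [act, Matrix.mulVec_add]
      map_smul' := fun c x => by simp [act, Matrix.mulVec_smul] }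

theorem actL_apply {ι κ : Type*} [Fintype ι] [Fintype κ] (A : Matrix ι κ ℝ)
    (x : EuclideanSpace ℝ κ) : actL A x = act A x := rfl

theorem actL_comp {ι κ ν : Type*} [Fintype ι] [Fintype κ] [Fintype ν] (A : Matrix ι κ ℝ)
    (B : Matrix κ ν ℝ) : (actL A).comp (actL B) = actL (A * B) := by
  ext1 x
  simp [actL_apply, act, Matrix.mulVec_mulVec]

theorem actL_sub {ι κ : Type*} [Fintype ι] [Fintype κ] (A B : Matrix ι κ ℝ) :
    actL (A - B) = actL A - actL B := by
  ext1 x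
  simp [actL_apply, act, Matrix.sub_mulVec]

theorem actL_neg {ι κ : Type*} [Fintype ι] [Fintype κ] (A : Matrix ι κ ℝ) :
    actL (-A) = -actL A := by
  ext1 x
  simp [actL_apply, act, Matrix.neg_mulVec]

theorem evec_mat (x : EuclideanSpace ℝ (Coord p)) : evec (mat x.ofLp) = x := rfl

theorem mat_evec (A : Matrix (Fin p) (Fin p) ℝ) : mat (evec A).ofLp = A := rfl

section Inverse

attribute [local instance] Matrix.linftyOpNormedRing Matrix.linftyOpNormedAlgebra

/-- `mat` as a continuous linear equivalence. -/
def matCLE (p : ℕ) : EuclideanSpace ℝ (Coord p) ≃L[ℝ] Matrix (Fin p) (Fin p) ℝ :=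
  LinearEquiv.toContinuousLinearEquiv
    { toFun := fun x => mat x.ofLp
      invFun := evec
      left_inv := fun _ => rfl
      right_inv := fun _ => rfl
      map_add' := fun _ _ => rfl
      map_smul' := fun _ _ => rfl }

/-- The derivative of inversion is H ↦ −B⁻¹ H B⁻¹. The local operator norm serves only to make the
matrices a normed algebra; the statement lives on Euclidean space. -/
theorem hasStrictFDerivAt_evec_inv {B : Matrix (Fin p) (Fin p) ℝ} (hB : B.PosDef) :
    HasStrictFDerivAt (fun x : EuclideanSpace ℝ (Coord p) => evec (mat x.ofLp)⁻¹)
      (-actL (B⁻¹ ⊗ₖ B⁻¹)) (evec B) := by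
  have hs : (B⁻¹)ᵀ = B⁻¹ := isHermitian_iff_isSymm.1 hB.inv.1
  obtain ⟨u, hu⟩ := hB.isUnit
  have huinv : (↑u⁻¹ : Matrix (Fin p) (Fin p) ℝ) = B⁻¹ := by
    rw [← hu, Matrix.coe_units_inv]
  have h := hasStrictFDerivAt_ringInverse (𝕜 := ℝ) u
  rw [hu] at h
  have h1 : HasStrictFDerivAt (fun x => (matCLE p).symm (Ring.inverse (matCLE p x)))
      ((matCLE p).symm.toContinuousLinearMap.comp
        ((-ContinuousLinearMap.mulLeftRight ℝ (Matrix (Fin p) (Fin p) ℝ) ↑u⁻¹ ↑u⁻¹).comp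
          (matCLE p).toContinuousLinearMap)) (evec B) :=
    (matCLE p).symm.toContinuousLinearMap.hasStrictFDerivAt.comp (evec B)
      (HasStrictFDerivAt.comp (evec B) (f := matCLE p) h (matCLE p).hasStrictFDerivAt)
  refine (h1.congr_fderiv ?_).congr_of_eventuallyEq (Eventually.of_forall fun x => ?_)
  · ext1 x
    have hx : actL (B⁻¹ ⊗ₖ B⁻¹) x = evec (B⁻¹ * mat x.ofLp * B⁻¹) := by
      rw [actL_apply, act, ← vec_mat x.ofLp, Matrix.kronecker_mulVec_vec, hs]
      rfl
    rw [neg_apply, hx, huinv]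
    rfl
  · simp only
    rw [← Matrix.nonsing_inv_eq_ringInverse]
    rfl

end Inverse

theorem continuous_mat : Continuous fun x : EuclideanSpace ℝ (Coord p) => mat x.ofLp :=
  continuous_pi fun i => continuous_pi fun j =>
    (EuclideanSpace.proj (𝕜 := ℝ) ((j, i) : Coord p)).continuous

theorem continuous_evec : Continuous (evec (p := p)) := by
  refine (PiLp.continuous_toLp 2 _).comp (continuous_pi fun c => ?_)
  exact continuous_id.matrix_elem c.2 c.1

/-- The projection of `ℝ^(p²)` onto the coordinates of the edges and of the diagonal. -/
def keepMat (G : SimpleGraph (Fin p)) [DecidableRel G.Adj] : Matrix (Coord p) (Coord p) ℝ :=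
  Matrix.diagonal fun c => if G.Adj c.2 c.1 ∨ c.2 = c.1 then 1 else 0

/-! ### h_G as a local inverse -/

section Constraint

variable (G : SimpleGraph (Fin p)) [DecidableRel G.Adj]

/-- The entries of `B` at the edges and on the diagonal, and the entries of `B⁻¹` elsewhere. -/
def constraintMap (x : EuclideanSpace ℝ (Coord p)) : EuclideanSpace ℝ (Coord p) :=
  act (keepMat G) x + act (1 - keepMat G) (evec (mat x.ofLp)⁻¹)

theorem act_keepMat_apply (x : EuclideanSpace ℝ (Coord p)) (i j : Fin p) :
    act (keepMat G) x (j, i) = if G.Adj i j ∨ i = j then x (j, i) else 0 := by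
  simp [act, keepMat, Matrix.mulVec_diagonal]

theorem act_one_sub_keepMat_apply (x : EuclideanSpace ℝ (Coord p)) (i j : Fin p) :
    act (1 - keepMat G) x (j, i) = if G.Adj i j ∨ i = j then 0 else x (j, i) := by
  have h := act_keepMat_apply G x i j
  simp only [act] at h ⊢
  rw [Matrix.sub_mulVec, Matrix.one_mulVec, Pi.sub_apply, h]
  split_ifs <;> simp

theorem constraintMap_evec_apply (A : Matrix (Fin p) (Fin p) ℝ) (i j : Fin p) :
    constraintMap G (evec A) (j, i) = if G.Adj i j ∨ i = j then A i j else A⁻¹ i j := by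
  rw [constraintMap, PiLp.add_apply, act_keepMat_apply, act_one_sub_keepMat_apply, mat_evec]
  split_ifs <;> simp [evec]

theorem hasStrictFDerivAt_constraintMap {B : Matrix (Fin p) (Fin p) ℝ} (hB : B.PosDef) :
    HasStrictFDerivAt (constraintMap G)
      (actL (keepMat G - (1 - keepMat G) * (B⁻¹ ⊗ₖ B⁻¹))) (evec B) := by
  have h := (actL (keepMat G)).hasStrictFDerivAt (x := evec B) |>.add
    ((actL (1 - keepMat G)).hasStrictFDerivAt.comp (evec B) (hasStrictFDerivAt_evec_inv hB))
  refine h.congr_fderiv ?_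
  rw [actL_sub (keepMat G), ← actL_comp, ContinuousLinearMap.comp_neg, ← sub_eq_add_neg]

theorem kronecker_self_mulVec_vec {B : Matrix (Fin p) (Fin p) ℝ} (hB : B.IsSymm)
    (X : Matrix (Fin p) (Fin p) ℝ) :
    (B ⊗ₖ B) *ᵥ Matrix.vec X = Matrix.vec (B * X * B) := by
  rw [Matrix.kronecker_mulVec_vec, hB.eq]

theorem eq_zero_of_constraint {B X : Matrix (Fin p) (Fin p) ℝ} (hB : B.PosDef)
    (h1 : ∀ i j, G.Adj i j ∨ i = j → X i j = 0)
    (h2 : ∀ i j, ¬ (G.Adj i j ∨ i = j) → (B⁻¹ * X * B⁻¹) i j = 0) : X = 0 :=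
  eq_zero_of_disjoint_support hB.inv hB.inv fun i j => by
    by_cases h : G.Adj i j ∨ i = j
    · exact Or.inl (h1 i j h)
    · exact Or.inr (h2 i j h)

/-- The infinitesimal form of uniqueness: a kernel element X vanishes at the kept positions and B⁻¹
X B⁻¹ vanishes elsewhere. -/
theorem actL_constraint_injective {B : Matrix (Fin p) (Fin p) ℝ} (hB : B.PosDef) :
    Function.Injective (actL (keepMat G - (1 - keepMat G) * (B⁻¹ ⊗ₖ B⁻¹))) := by
  rw [injective_iff_map_eq_zero]
  intro x hx
  rw [actL_sub (keepMat G), ← actL_comp] at hx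
  have hs : (B⁻¹).IsSymm := isHermitian_iff_isSymm.1 hB.inv.1
  have hx' : ∀ i j, (if G.Adj i j ∨ i = j then x (j, i) else 0) -
      (if G.Adj i j ∨ i = j then 0 else (B⁻¹ * mat x.ofLp * B⁻¹) i j) = 0 := fun i j => by
    have h := congrArg (fun y : EuclideanSpace ℝ (Coord p) => y (j, i)) hx
    have hW : act (B⁻¹ ⊗ₖ B⁻¹) x = evec (B⁻¹ * mat x.ofLp * B⁻¹) := by
      rw [act, ← vec_mat x.ofLp, kronecker_self_mulVec_vec hs]
      rfl
    simp only at h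
    rw [sub_apply, ContinuousLinearMap.comp_apply, PiLp.sub_apply, actL_apply, actL_apply,
      actL_apply, hW, act_keepMat_apply, act_one_sub_keepMat_apply] at h
    exact h
  have h0 : mat x.ofLp = 0 := by
    refine eq_zero_of_constraint G hB (fun i j h => ?_) (fun i j h => ?_)
    · have := hx' i j
      rwa [if_pos h, if_pos h, sub_zero] at this
    · have := hx' i j
      rwa [if_neg h, if_neg h, zero_sub, neg_eq_zero] at this
  rw [← evec_mat x, h0]
  rfl

/-- The derivative of `constraintMap` at a positive definite matrix, as an equivalence. -/
def constraintEquiv {B : Matrix (Fin p) (Fin p) ℝ} (hB : B.PosDef) :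
    EuclideanSpace ℝ (Coord p) ≃L[ℝ] EuclideanSpace ℝ (Coord p) :=
  (LinearEquiv.ofInjectiveEndo
    (actL (keepMat G - (1 - keepMat G) * (B⁻¹ ⊗ₖ B⁻¹))).toLinearMap
    (actL_constraint_injective G hB)).toContinuousLinearEquiv

theorem hasStrictFDerivAt_constraintMap_equiv {B : Matrix (Fin p) (Fin p) ℝ} (hB : B.PosDef) :
    HasStrictFDerivAt (constraintMap G)
      (constraintEquiv G hB : EuclideanSpace ℝ (Coord p) →L[ℝ] EuclideanSpace ℝ (Coord p))
      (evec B) :=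
  hasStrictFDerivAt_constraintMap G hB

theorem constraintMap_evec_eq_iff {A B : Matrix (Fin p) (Fin p) ℝ} :
    constraintMap G (evec B) = act (keepMat G) (evec A) ↔
      (∀ i j, G.Adj i j ∨ i = j → B i j = A i j) ∧
        ∀ i j, ¬ G.Adj i j → i ≠ j → B⁻¹ i j = 0 := by
  constructor
  · intro h
    have h' : ∀ i j, (if G.Adj i j ∨ i = j then B i j else B⁻¹ i j) =
        if G.Adj i j ∨ i = j then A i j else 0 := fun i j => by
      rw [← constraintMap_evec_apply, h, act_keepMat_apply]
      rfl
    refine ⟨fun i j hij => ?_, fun i j h1 h2 => ?_⟩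
    · simpa [hij] using h' i j
    · simpa [h1, h2] using h' i j
  · rintro ⟨h1, h2⟩
    ext ⟨j, i⟩
    rw [constraintMap_evec_apply, act_keepMat_apply]
    split_ifs with h
    · exact h1 i j h
    · push Not at h
      exact h2 i j h.1 h.2

/-- The local inverse knows nothing of symmetry; together with local injectivity, this invariance
under transposition restores it. -/
theorem constraintMap_evec_transpose {A B : Matrix (Fin p) (Fin p) ℝ} (hA : A.IsSymm)
    (h : constraintMap G (evec B) = act (keepMat G) (evec A)) :
    constraintMap G (evec Bᵀ) = act (keepMat G) (evec A) := by
  rw [constraintMap_evec_eq_iff] at h ⊢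
  refine ⟨fun i j hij => ?_, fun i j h1 h2 => ?_⟩
  · rw [Matrix.transpose_apply, h.1 j i (hij.imp (fun h => h.symm) Eq.symm), hA.apply]
  · rw [← Matrix.transpose_nonsing_inv, Matrix.transpose_apply]
    exact h.2 j i (fun h => h1 h.symm) h2.symm

/-- The vectors `vec A` of the symmetric matrices `A`. -/
def symSet (p : ℕ) : Set (EuclideanSpace ℝ (Coord p)) := {x | (mat x.ofLp).IsSymm}

theorem isClosed_symSet : IsClosed (symSet p) :=
  isClosed_eq continuous_mat.matrix_transpose continuous_mat

/-- `h_G` as a function on `ℝ^(p²)`. -/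
def hGvec (x : EuclideanSpace ℝ (Coord p)) : EuclideanSpace ℝ (Coord p) :=
  evec (hG G (mat x.ofLp))

theorem continuous_transpose_evec :
    Continuous fun x : EuclideanSpace ℝ (Coord p) => evec (mat x.ofLp)ᵀ :=
  continuous_evec.comp continuous_mat.matrix_transpose

/-- Differentiability is claimed only within `symSet` because h_G is 0 at every non-symmetric
matrix. For symmetric x near vec V the local inverse at the kept entries of x solves the
constraints, and it is symmetric and positive definite, so uniqueness identifies it with h_G. -/
theorem hasFDerivWithinAt_hGvec_constraint {V : Matrix (Fin p) (Fin p) ℝ} (hV : V.PosDef) :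
    HasFDerivWithinAt (hGvec G)
      ((constraintEquiv G (isConstrained_hG G hV).1).symm.toContinuousLinearMap.comp
        (actL (keepMat G))) (symSet p) (evec V) := by
  have hc := isConstrained_hG G hV
  have hVG := hc.1
  have hVs := isHermitian_iff_isSymm.1 hV.1
  have hVGs := isHermitian_iff_isSymm.1 hVG.1
  have hd := hasStrictFDerivAt_constraintMap_equiv G hVG
  set g := hd.localInverse with hg
  have hval : constraintMap G (evec (hG G V)) = act (keepMat G) (evec V) :=
    (constraintMap_evec_eq_iff G).2 ⟨hc.2.1, hc.2.2⟩
  have hkeep : Continuous fun x => act (keepMat G) x := (actL (keepMat G)).continuous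
  have hgd : HasStrictFDerivAt g _ (act (keepMat G) (evec V)) := hval ▸ hd.to_localInverse
  have hgV : g (act (keepMat G) (evec V)) = evec (hG G V) := by
    rw [← hval]
    exact hd.localInverse_apply_image
  have hcomp : HasFDerivAt (fun x => g (act (keepMat G) x)) _ (evec V) :=
    HasFDerivAt.comp (evec V) (f := actL (keepMat G)) hgd.hasFDerivAt
      (actL (keepMat G)).hasFDerivAt
  have hct : Tendsto (fun x => g (act (keepMat G) x)) (𝓝 (evec V)) (𝓝 (evec (hG G V))) := by
    have := hcomp.continuousAt.tendsto
    rwa [hgV] at this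
  have hright : ∀ᶠ x in 𝓝 (evec V),
      constraintMap G (g (act (keepMat G) x)) = act (keepMat G) x :=
    (hkeep.tendsto (evec V)).eventually (hval ▸ hd.eventually_right_inverse)
  -- The transposed solution is also close to h_G(V), so the local inverse recovers it from its
  -- image, which equals that of the solution itself.
  have hleft : ∀ᶠ x in 𝓝 (evec V),
      g (constraintMap G (evec (mat (g (act (keepMat G) x)).ofLp)ᵀ)) =
        evec (mat (g (act (keepMat G) x)).ofLp)ᵀ := by
    have ht : Tendsto (fun x => evec (mat (g (act (keepMat G) x)).ofLp)ᵀ) (𝓝 (evec V))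
        (𝓝 (evec (hG G V))) := by
      have := (continuous_transpose_evec.tendsto (evec (hG G V))).comp hct
      rwa [mat_evec, hVGs.eq] at this
    exact ht.eventually hd.eventually_left_inverse
  have hpos : ∀ᶠ x in 𝓝 (evec V), mat (g (act (keepMat G) x)).ofLp ∈ posForm p :=
    ((continuous_mat.tendsto _).comp hct).eventually
      (isOpen_posForm.mem_nhds (posDef_iff_isSymm_and_mem_posForm.1 hVG).2)
  have hposV : ∀ᶠ x in 𝓝 (evec V), mat x.ofLp ∈ posForm p :=
    (continuous_mat.tendsto _).eventually
      (isOpen_posForm.mem_nhds (posDef_iff_isSymm_and_mem_posForm.1 hV).2)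
  have heq : ∀ᶠ x in 𝓝 (evec V), x ∈ symSet p → hGvec G x = g (act (keepMat G) x) := by
    filter_upwards [hright, hleft, hpos, hposV] with x h1 h2 h3 h4 hx
    have h1' : constraintMap G (evec (mat (g (act (keepMat G) x)).ofLp)) =
        act (keepMat G) (evec (mat x.ofLp)) := h1
    rw [constraintMap_evec_transpose G hx h1', evec_mat] at h2
    have hsym : (mat (g (act (keepMat G) x)).ofLp).IsSymm := by
      have := congrArg (fun y : EuclideanSpace ℝ (Coord p) => mat y.ofLp) h2
      exact this.symm
    have hA := posDef_iff_isSymm_and_mem_posForm.2 ⟨hx, h4⟩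
    have hB := (constraintMap_evec_eq_iff G).1 h1'
    rw [hGvec, IsConstrained.hG_eq hA
      ⟨posDef_iff_isSymm_and_mem_posForm.2 ⟨hsym, h3⟩, hB.1, hB.2⟩, evec_mat]
  refine hcomp.hasFDerivWithinAt.congr_of_eventuallyEq ?_ ?_
  · exact eventually_nhdsWithin_iff.2 heq
  · rw [hgV]
    rfl

end Constraint

/-! ### The closed form of the derivative -/

section Derivative

variable (G : SimpleGraph (Fin p)) [DecidableRel G.Adj]

theorem mem_nonEdgePos {i j : Fin p} : (i, j) ∈ nonEdgePos G ↔ j < i ∧ ¬ G.Adj i j := by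
  simp [nonEdgePos]

theorem mem_edgePos {i j : Fin p} : (i, j) ∈ edgePos G ↔ (j < i ∧ G.Adj i j) ∨ i = j := by
  simp [edgePos]

/-- D(G) is strictly below the diagonal, so it never contains a position and its mirror image;
symmetrization just halves each selected entry. -/
theorem QD_mul_symMat_mul_transpose :
    QD G * symMat p * (QD G)ᵀ = (1 / 2 : ℝ) • (1 : Matrix (nonEdgePos G) (nonEdgePos G) ℝ) := by
  refine Matrix.ext_of_mulVec_single fun w => ?_
  rw [← Matrix.mulVec_mulVec, ← Matrix.mulVec_mulVec, transpose_selMat_mulVec, symMat_mulVec_vec]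
  ext ⟨⟨i, j⟩, hz⟩
  rw [selMat_mulVec_vec]
  have h1 := (mem_nonEdgePos G).1 hz
  have h2 : (j, i) ∉ nonEdgePos G := fun h => lt_asymm h1.1 ((mem_nonEdgePos G).1 h).1
  simp [fill, hz, h2, Matrix.smul_apply, Matrix.one_apply, Pi.single_apply]

theorem symMat_mul_QD_transpose_mulVec_injective :
    Function.Injective (symMat p * (QD G)ᵀ).mulVec := by
  intro x y h
  have h' := congrArg (fun z => (2 : ℝ) • (QD G *ᵥ z)) h
  simpa only [Matrix.mulVec_mulVec, ← Matrix.mul_assoc, QD_mul_symMat_mul_transpose,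
    Matrix.smul_mulVec, Matrix.one_mulVec, smul_smul, one_div, mul_inv_cancel₀ (two_ne_zero' ℝ),
    one_smul] using h'

/-- M_p is idempotent and commutes with B⁻¹ ⊗ B⁻¹, so the core is the congruence of this positive
definite matrix by the injective M_p Q_Dᵀ. -/
theorem posDef_coreD {B : Matrix (Fin p) (Fin p) ℝ} (hB : B.PosDef) : (coreD G B).PosDef := by
  have h := (hB.inv.kronecker hB.inv).conjTranspose_mul_mul_same
    (symMat_mul_QD_transpose_mulVec_injective G)
  rw [Matrix.conjTranspose_eq_transpose_of_trivial, Matrix.transpose_mul,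
    Matrix.transpose_transpose, transpose_symMat] at h
  have h' : coreD G B = QD G * symMat p * (B⁻¹ ⊗ₖ B⁻¹) * (symMat p * (QD G)ᵀ) := by
    rw [coreD, ← Matrix.mul_assoc, Matrix.mul_assoc _ _ (symMat p), ← symMat_mul_kronecker,
      ← Matrix.mul_assoc, Matrix.mul_assoc _ (symMat p) (symMat p), symMat_mul_symMat]
  rwa [h']

theorem isUnit_coreD {B : Matrix (Fin p) (Fin p) ℝ} (hB : B.PosDef) : IsUnit (coreD G B) :=
  (posDef_coreD G hB).isUnit

theorem coreD_mul_inv {B : Matrix (Fin p) (Fin p) ℝ} (hB : B.PosDef) :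
    coreD G B * (coreD G B)⁻¹ = 1 :=
  Matrix.mul_nonsing_inv _ ((Matrix.isUnit_iff_isUnit_det _).1 (isUnit_coreD G hB))

/-- The explicit form of the derivative of `h_G`, in terms of `B = h_G(V)`. -/
def derivFormula (B : Matrix (Fin p) (Fin p) ℝ) : Matrix (Coord p) (Coord p) ℝ :=
  symMat p - symMat p * (QD G)ᵀ * (coreD G B)⁻¹ * QD G * (B⁻¹ ⊗ₖ B⁻¹) * symMat p

theorem symMat_mul_derivFormula (B : Matrix (Fin p) (Fin p) ℝ) :
    symMat p * derivFormula G B = derivFormula G B := by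
  simp only [derivFormula, Matrix.mul_sub, ← Matrix.mul_assoc, symMat_mul_symMat]

theorem derivFormula_mul_symMat (B : Matrix (Fin p) (Fin p) ℝ) :
    derivFormula G B * symMat p = derivFormula G B := by
  simp only [derivFormula, Matrix.sub_mul, Matrix.mul_assoc, symMat_mul_symMat]

theorem QD_mul_kronecker_mul_derivFormula {B : Matrix (Fin p) (Fin p) ℝ} (hB : B.PosDef) :
    QD G * (B⁻¹ ⊗ₖ B⁻¹) * derivFormula G B = 0 := by
  have h : QD G * (B⁻¹ ⊗ₖ B⁻¹) * (symMat p * (QD G)ᵀ * (coreD G B)⁻¹ * QD G *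
      (B⁻¹ ⊗ₖ B⁻¹) * symMat p) =
      (coreD G B * (coreD G B)⁻¹) * (QD G * (B⁻¹ ⊗ₖ B⁻¹) * symMat p) := by
    rw [coreD, Matrix.mul_assoc (QD G) (symMat p), symMat_mul_kronecker]
    simp only [Matrix.mul_assoc]
  rw [derivFormula, Matrix.mul_sub, h, coreD_mul_inv G hB, Matrix.one_mul, sub_self]

theorem isSymm_of_symMat_mulVec {X : Matrix (Fin p) (Fin p) ℝ}
    (h : symMat p *ᵥ Matrix.vec X = Matrix.vec X) : X.IsSymm := by
  rw [symMat_mulVec_vec, Matrix.vec_inj] at h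
  rw [← h]
  exact isSymm_half_add_transpose X

theorem isSymm_mat_symMat_mulVec (x : Coord p → ℝ) : (mat (symMat p *ᵥ x)).IsSymm := by
  refine isSymm_of_symMat_mulVec ?_
  rw [vec_mat, Matrix.mulVec_mulVec, symMat_mul_symMat]

theorem symMat_mul_QD_transpose_mulVec_apply (y : nonEdgePos G → ℝ) {i j : Fin p}
    (hij : G.Adj i j ∨ i = j) : ((symMat p * (QD G)ᵀ) *ᵥ y) (j, i) = 0 := by
  have h1 : (i, j) ∉ nonEdgePos G := fun h => by
    rw [mem_nonEdgePos] at h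
    exact hij.elim h.2 fun h' => h.1.ne' h'
  have h2 : (j, i) ∉ nonEdgePos G := fun h => by
    rw [mem_nonEdgePos] at h
    exact hij.elim (fun h' => h.2 h'.symm) fun h' => h.1.ne h'
  rw [← Matrix.mulVec_mulVec, transpose_selMat_mulVec, symMat_mulVec_vec]
  simp [fill, h1, h2]

theorem apply_eq_zero_of_QD {X : Matrix (Fin p) (Fin p) ℝ} (hX : X.IsSymm)
    (h : QD G *ᵥ Matrix.vec X = 0) {i j : Fin p} (hij : ¬ (G.Adj i j ∨ i = j)) : X i j = 0 := by
  have key : ∀ i j : Fin p, j < i → ¬ G.Adj i j → X i j = 0 := fun i j h1 h2 => by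
    rw [← selMat_mulVec_vec (nonEdgePos G) X ⟨(i, j), (mem_nonEdgePos G).2 ⟨h1, h2⟩⟩, h]
    rfl
  push Not at hij
  rcases lt_or_gt_of_ne hij.2 with h' | h'
  · rw [← hX.apply]
    exact key j i h' fun h => hij.1 h.symm
  · exact key i j h' hij.1

theorem derivFormula_mulVec_apply {B X : Matrix (Fin p) (Fin p) ℝ} (hX : X.IsSymm)
    {i j : Fin p} (hij : G.Adj i j ∨ i = j) :
    (derivFormula G B *ᵥ Matrix.vec X) (j, i) = X i j := by
  have h : derivFormula G B *ᵥ Matrix.vec X = Matrix.vec X - (symMat p * (QD G)ᵀ) *ᵥ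
      (((coreD G B)⁻¹ * QD G * (B⁻¹ ⊗ₖ B⁻¹) * symMat p) *ᵥ Matrix.vec X) := by
    rw [derivFormula, Matrix.sub_mulVec, symMat_mulVec_vec_of_isSymm hX, Matrix.mulVec_mulVec]
    simp only [Matrix.mul_assoc]
  rw [h, Pi.sub_apply, symMat_mul_QD_transpose_mulVec_apply G _ hij, sub_zero]
  rfl

theorem kronecker_mulVec_derivFormula_apply {B : Matrix (Fin p) (Fin p) ℝ} (hB : B.PosDef)
    (x : Coord p → ℝ) {i j : Fin p} (hij : ¬ (G.Adj i j ∨ i = j)) :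
    ((B⁻¹ ⊗ₖ B⁻¹) *ᵥ (derivFormula G B *ᵥ x)) (j, i) = 0 := by
  have h1 : symMat p *ᵥ ((B⁻¹ ⊗ₖ B⁻¹) *ᵥ (derivFormula G B *ᵥ x)) =
      (B⁻¹ ⊗ₖ B⁻¹) *ᵥ (derivFormula G B *ᵥ x) := by
    rw [Matrix.mulVec_mulVec, symMat_mul_kronecker, ← Matrix.mulVec_mulVec, Matrix.mulVec_mulVec _
      (symMat p), symMat_mul_derivFormula]
  rw [← vec_mat ((B⁻¹ ⊗ₖ B⁻¹) *ᵥ (derivFormula G B *ᵥ x))] at h1 ⊢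
  refine apply_eq_zero_of_QD G (isSymm_of_symMat_mulVec h1) ?_ hij
  rw [vec_mat, Matrix.mulVec_mulVec, Matrix.mulVec_mulVec, QD_mul_kronecker_mul_derivFormula G hB,
    Matrix.zero_mulVec]

/-- No inverse is computed: applying the linearized constraint to the closed form returns the kept
entries of the symmetrized argument and zeros elsewhere. -/
theorem constraintEquiv_symm_comp {B : Matrix (Fin p) (Fin p) ℝ} (hB : B.PosDef) :
    ((constraintEquiv G hB).symm.toContinuousLinearMap.comp (actL (keepMat G))).comp
      (actL (symMat p)) = actL (derivFormula G B) := by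
  ext1 x
  rw [ContinuousLinearMap.comp_apply, ContinuousLinearMap.comp_apply]
  refine (ContinuousLinearEquiv.symm_apply_eq _).2 ?_
  change act (keepMat G) (act (symMat p) x) =
    actL (keepMat G - (1 - keepMat G) * (B⁻¹ ⊗ₖ B⁻¹)) (act (derivFormula G B) x)
  rw [actL_sub (keepMat G), ← actL_comp, sub_apply, ContinuousLinearMap.comp_apply,
    actL_apply, actL_apply, actL_apply]
  ext ⟨j, i⟩
  rw [PiLp.sub_apply, act_keepMat_apply, act_keepMat_apply, act_one_sub_keepMat_apply]
  split_ifs with h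
  · have h' := derivFormula_mulVec_apply G (B := B)
      (isSymm_mat_symMat_mulVec (p := p) x.ofLp) h
    rw [vec_mat, Matrix.mulVec_mulVec, derivFormula_mul_symMat] at h'
    rw [sub_zero]
    exact h'.symm
  · have h' := kronecker_mulVec_derivFormula_apply G hB x.ofLp h
    rw [zero_sub, eq_comm, neg_eq_zero]
    exact h'

theorem act_symMat_of_mem_symSet {x : EuclideanSpace ℝ (Coord p)} (hx : x ∈ symSet p) :
    act (symMat p) x = x := by
  rw [act, ← vec_mat x.ofLp, symMat_mulVec_vec_of_isSymm hx]
  rfl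

theorem hasFDerivWithinAt_hGvec {V : Matrix (Fin p) (Fin p) ℝ} (hV : V.PosDef) :
    HasFDerivWithinAt (hGvec G) (actL (derivFormula G (hG G V))) (symSet p) (evec V) := by
  have hVs : evec V ∈ symSet p := isHermitian_iff_isSymm.1 hV.1
  have hMV : actL (symMat p) (evec V) = evec V := act_symMat_of_mem_symSet hVs
  have h := hasFDerivWithinAt_hGvec_constraint G hV
  -- Symmetrization fixes `symSet`, so precomposing with it changes nothing there, yet it turns the
  -- derivative into the closed form.
  rw [← hMV] at h
  have h' := h.comp (evec V) (actL (symMat p)).hasFDerivWithinAt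
    (s := symSet p) fun x _ => isSymm_mat_symMat_mulVec x.ofLp
  rw [constraintEquiv_symm_comp] at h'
  refine h'.congr (fun x hx => ?_) ?_
  · simp only [Function.comp_apply, actL_apply, act_symMat_of_mem_symSet hx]
  · simp only [Function.comp_apply, hMV]

/-- D_p maps all of ℝ^m into `symSet`, which upgrades the derivative within that set to a full one.
-/
theorem hasFDerivAt_tildeFun_hG {V : Matrix (Fin p) (Fin p) ℝ} (hV : V.PosDef) :
    HasFDerivAt (tildeFun (hG G))
      (Matrix.toLin' (dupPinv p * derivFormula G (hG G V) * dupMat p)).toContinuousLinearMap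
      (vech V) := by
  have hVs := isHermitian_iff_isSymm.1 hV.1
  let d : (LowerPos p → ℝ) →L[ℝ] EuclideanSpace ℝ (Coord p) :=
    ((PiLp.continuousLinearEquiv 2 ℝ fun _ : Coord p => ℝ).symm.toContinuousLinearMap).comp
      (Matrix.toLin' (dupMat p)).toContinuousLinearMap
  let c : EuclideanSpace ℝ (Coord p) →L[ℝ] (LowerPos p → ℝ) :=
    (Matrix.toLin' (dupPinv p)).toContinuousLinearMap.comp
      (PiLp.continuousLinearEquiv 2 ℝ fun _ : Coord p => ℝ).toContinuousLinearMap
  have hd : d (vech V) = evec V := by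
    change WithLp.toLp 2 (dupMat p *ᵥ vech V) = _
    rw [dupMat_mulVec_vech hVs]
    rfl
  have h := hasFDerivWithinAt_hGvec G hV
  rw [← hd] at h
  have h' := h.comp_hasFDerivAt (vech V) d.hasFDerivAt
    (Eventually.of_forall fun x => isSymm_mat_dupMat_mulVec x)
  have h'' := c.hasFDerivAt.comp (vech V) h'
  refine h''.congr_fderiv ?_
  ext1 x
  change dupPinv p *ᵥ (derivFormula G (hG G V) *ᵥ (dupMat p *ᵥ x)) = Matrix.toLin' _ x
  simp only [Matrix.toLin'_apply, Matrix.mulVec_mulVec, Matrix.mul_assoc]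

theorem derivMat_hG {V : Matrix (Fin p) (Fin p) ℝ} (hV : V.PosDef) :
    derivMat (hG G) V = derivFormula G (hG G V) := by
  rw [derivMat, (hasFDerivAt_tildeFun_hG G hV).fderiv, LinearMap.coe_toContinuousLinearMap,
    LinearMap.toMatrix'_toLin', ← Matrix.mul_assoc, ← Matrix.mul_assoc, dupMat_mul_dupPinv,
    Matrix.mul_assoc, dupMat_mul_dupPinv, symMat_mul_derivFormula, derivFormula_mul_symMat]

end Derivative

/-! ### Covariance algebra -/

section Covariance

variable (G : SimpleGraph (Fin p)) [DecidableRel G.Adj]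

/-- With B = h_G(V), B satisfies the two conditions that determine the image of V: it has the kept
entries of V, and B⁻¹ B B⁻¹ = B⁻¹ vanishes at the non-edges. -/
theorem derivFormula_mulVec_vec {V : Matrix (Fin p) (Fin p) ℝ} (hV : V.PosDef) :
    derivFormula G (hG G V) *ᵥ Matrix.vec V = Matrix.vec (hG G V) := by
  obtain ⟨hB, h1, h2⟩ := isConstrained_hG G hV
  have hs : ((hG G V)⁻¹).IsSymm := isHermitian_iff_isSymm.1 hB.inv.1
  have hu := isUnit_det_of_posDef hB
  have h0 : mat (derivFormula G (hG G V) *ᵥ Matrix.vec V) - hG G V = 0 := by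
    refine eq_zero_of_constraint G hB (fun i j hij => ?_) (fun i j hij => ?_)
    · rw [Matrix.sub_apply, h1 i j hij, sub_eq_zero]
      exact derivFormula_mulVec_apply G (isHermitian_iff_isSymm.1 hV.1) hij
    · have h := kronecker_mulVec_derivFormula_apply G hB (Matrix.vec V) hij
      rw [← vec_mat (derivFormula G (hG G V) *ᵥ Matrix.vec V), kronecker_self_mulVec_vec hs] at h
      push Not at hij
      rw [Matrix.mul_sub, Matrix.sub_mul, Matrix.sub_apply, Matrix.nonsing_inv_mul _ hu,
        Matrix.one_mul, h2 i j hij.1 hij.2, sub_zero]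
      exact h
  exact congrArg Matrix.vec (sub_eq_zero.1 h0)

theorem vecMulVec_conj {ι κ : Type*} [Fintype κ] (L : Matrix ι κ ℝ) (a : κ → ℝ) :
    L * Matrix.vecMulVec a a * Lᵀ = Matrix.vecMulVec (L *ᵥ a) (L *ᵥ a) := by
  rw [Matrix.mul_vecMulVec, Matrix.vecMulVec_mul, Matrix.vecMul_transpose]

theorem conj_WV {ι : Type*} (s₁ s₂ : ℝ) (V : Matrix (Fin p) (Fin p) ℝ)
    {L : Matrix ι (Coord p) ℝ} (hL : L * symMat p = L) :
    L * WV s₁ s₂ V * Lᵀ = (2 * s₁) • (L * (V ⊗ₖ V) * Lᵀ) +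
      s₂ • Matrix.vecMulVec (L *ᵥ Matrix.vec V) (L *ᵥ Matrix.vec V) := by
  rw [WV, Matrix.mul_add, Matrix.add_mul, Matrix.mul_smul, Matrix.smul_mul, Matrix.mul_smul,
    Matrix.smul_mul, ← Matrix.mul_assoc, hL, vecOuter, vecMulVec_conj]

theorem WVG_eq_conj_WV (s₁ s₂ : ℝ) {V : Matrix (Fin p) (Fin p) ℝ} (hV : V.PosDef) :
    WVG G s₁ s₂ V = derivMat (hG G) V * WV s₁ s₂ V * (derivMat (hG G) V)ᵀ := by
  rw [derivMat_hG G hV, conj_WV s₁ s₂ V (derivFormula_mul_symMat G _),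
    derivFormula_mulVec_vec G hV, WVG, derivMat_hG G hV]
  rfl

theorem kronecker_self_isSymm {V : Matrix (Fin p) (Fin p) ℝ} (hV : V.IsSymm) :
    (V ⊗ₖ V)ᵀ = V ⊗ₖ V := by
  rw [← Matrix.kroneckerMap_transpose, hV.eq]

theorem posSemidef_WV {s₁ s₂ : ℝ} (h₁ : 0 ≤ s₁) (h₂ : -(2 * s₁ / p) ≤ s₂)
    {V : Matrix (Fin p) (Fin p) ℝ} (hV : V.PosDef) : (WV s₁ s₂ V).PosSemidef := by
  have hs := isHermitian_iff_isSymm.1 hV.1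
  have hu := isUnit_det_of_posDef hV
  rw [Matrix.posSemidef_iff_dotProduct_mulVec]
  constructor
  · rw [Matrix.IsHermitian, Matrix.conjTranspose_eq_transpose_of_trivial, WV, Matrix.transpose_add,
      Matrix.transpose_smul, Matrix.transpose_smul, Matrix.transpose_mul, kronecker_self_isSymm hs,
      transpose_symMat, ← symMat_mul_kronecker, vecOuter, Matrix.transpose_vecMulVec]
  intro x
  rw [star_trivial]
  set y := symMat p *ᵥ x with hy
  have hquad : x ⬝ᵥ (symMat p * (V ⊗ₖ V)) *ᵥ x = y ⬝ᵥ (V ⊗ₖ V) *ᵥ y := by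
    rw [← symMat_mul_symMat, Matrix.mul_assoc, symMat_mul_kronecker, ← Matrix.mulVec_mulVec,
      ← Matrix.mulVec_mulVec, Matrix.dotProduct_mulVec, ← Matrix.mulVec_transpose,
      transpose_symMat]
  have hlin : Matrix.vec V ⬝ᵥ x = Matrix.vec V ⬝ᵥ y := by
    rw [hy, Matrix.dotProduct_mulVec, ← Matrix.mulVec_transpose, transpose_symMat,
      symMat_mulVec_vec_of_isSymm hs]
  have hform : x ⬝ᵥ WV s₁ s₂ V *ᵥ x =
      2 * s₁ * (y ⬝ᵥ (V ⊗ₖ V) *ᵥ y) + s₂ * (Matrix.vec V ⬝ᵥ y) ^ 2 := by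
    rw [WV, Matrix.add_mulVec, dotProduct_add, Matrix.smul_mulVec, Matrix.smul_mulVec,
      dotProduct_smul, dotProduct_smul, hquad, vecOuter, Matrix.vecMulVec_mulVec]
    simp only [op_smul_eq_smul, dotProduct_smul, smul_eq_mul]
    rw [dotProduct_comm x, hlin]
    ring
  rw [hform]
  have hpsd := (hV.kronecker hV).posSemidef
  -- For p = 0 the bound on σ₂ involves division by zero, but all sums are empty.
  rcases Nat.eq_zero_or_pos p with hp | hp
  · subst hp
    simp [dotProduct]
  have hp' : (0 : ℝ) < p := Nat.cast_pos.2 hp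
  set q := y ⬝ᵥ (V ⊗ₖ V) *ᵥ y with hq
  set l := Matrix.vec V ⬝ᵥ y with hl
  have hVv : (V ⊗ₖ V) *ᵥ Matrix.vec V⁻¹ = Matrix.vec V := by
    rw [kronecker_self_mulVec_vec hs, Matrix.mul_nonsing_inv _ hu, Matrix.one_mul]
  -- Cauchy–Schwarz for the form V ⊗ V between y and vec V⁻¹, whose squared length is p: expand the
  -- form at the residual of y along vec V⁻¹.
  have hcs : l ^ 2 ≤ p * q := by
    have h := hpsd.dotProduct_mulVec_nonneg (y - (l / p) • Matrix.vec V⁻¹)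
    have hvv : Matrix.vec V⁻¹ ⬝ᵥ Matrix.vec V = p := by
      rw [Matrix.vec_dotProduct_vec, Matrix.transpose_nonsing_inv, hs.eq,
        Matrix.nonsing_inv_mul _ hu, Matrix.trace_one, Fintype.card_fin]
    have hvy : Matrix.vec V⁻¹ ⬝ᵥ (V ⊗ₖ V) *ᵥ y = l := by
      rw [Matrix.dotProduct_mulVec, ← Matrix.mulVec_transpose, kronecker_self_isSymm hs, hVv]
    rw [star_trivial, Matrix.mulVec_sub, Matrix.mulVec_smul, hVv, sub_dotProduct, dotProduct_sub,
      dotProduct_sub, smul_dotProduct, smul_dotProduct, dotProduct_smul, dotProduct_smul, hvv,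
      hvy, dotProduct_comm y (Matrix.vec V), ← hl, ← hq] at h
    simp only [smul_eq_mul] at h
    have h' : 0 ≤ p * (q - l / p * l - (l / p * l - l / p * (l / p * p))) :=
      mul_nonneg hp'.le h
    have h'' : (p : ℝ) * (q - l / p * l - (l / p * l - l / p * (l / p * p))) = p * q - l ^ 2 := by
      field_simp
      ring
    linarith
  have h3 : -(2 * s₁) ≤ s₂ * p := by
    have := mul_le_mul_of_nonneg_right h₂ hp'.le
    rwa [neg_mul, div_mul_cancel₀ _ hp'.ne'] at this
  -- 2σ₁pq ≥ 2σ₁l², and σ₂pl² ≥ −2σ₁l².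
  have h4 : 0 ≤ p * (2 * s₁ * q + s₂ * l ^ 2) := by
    nlinarith [mul_le_mul_of_nonneg_left hcs h₁, mul_le_mul_of_nonneg_right h3 (sq_nonneg l)]
  exact nonneg_of_mul_nonneg_right h4 hp'

theorem posSemidef_conj {ι κ : Type*} [Fintype ι] [Fintype κ] {S : Matrix κ κ ℝ}
    (hS : S.PosSemidef) (L : Matrix ι κ ℝ) : (L * S * Lᵀ).PosSemidef := by
  simpa using hS.mul_mul_conjTranspose_same L

theorem kronecker_inv_mul_kronecker {V : Matrix (Fin p) (Fin p) ℝ} (hV : V.PosDef) :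
    (V⁻¹ ⊗ₖ V⁻¹) * (V ⊗ₖ V) = 1 := by
  rw [← Matrix.mul_kronecker_mul, Matrix.nonsing_inv_mul _ (isUnit_det_of_posDef hV),
    Matrix.one_kronecker_one]

theorem kronecker_mul_kronecker_inv {V : Matrix (Fin p) (Fin p) ℝ} (hV : V.PosDef) :
    (V ⊗ₖ V) * (V⁻¹ ⊗ₖ V⁻¹) = 1 := by
  rw [← Matrix.mul_kronecker_mul, Matrix.mul_nonsing_inv _ (isUnit_det_of_posDef hV),
    Matrix.one_kronecker_one]

theorem derivFormula_mul_QD_transpose {V : Matrix (Fin p) (Fin p) ℝ} (hV : V.PosDef) :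
    derivFormula G V * (QD G)ᵀ = 0 := by
  have h : symMat p * (QD G)ᵀ * (coreD G V)⁻¹ * QD G * (V⁻¹ ⊗ₖ V⁻¹) * symMat p * (QD G)ᵀ =
      symMat p * (QD G)ᵀ * ((coreD G V)⁻¹ * coreD G V) := by
    rw [coreD, Matrix.mul_assoc (QD G) (symMat p), symMat_mul_kronecker]
    simp only [Matrix.mul_assoc]
  rw [derivFormula, Matrix.sub_mul, h,
    Matrix.nonsing_inv_mul _ ((Matrix.isUnit_iff_isUnit_det _).1 (isUnit_coreD G hV)),
    Matrix.mul_one, sub_self]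

/-- The subtracted term starts with M_p Q_Dᵀ, which T annihilates. -/
theorem derivFormula_mul_self {V : Matrix (Fin p) (Fin p) ℝ} (hV : V.PosDef) :
    derivFormula G V * derivFormula G V = derivFormula G V := by
  have h : derivFormula G V * (symMat p * (QD G)ᵀ * (coreD G V)⁻¹ * QD G *
      (V⁻¹ ⊗ₖ V⁻¹) * symMat p) = 0 := by
    simp only [← Matrix.mul_assoc, derivFormula_mul_symMat, derivFormula_mul_QD_transpose G hV,
      Matrix.zero_mul]
  nth_rw 2 [derivFormula]
  rw [Matrix.mul_sub, h, sub_zero, derivFormula_mul_symMat]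

theorem derivFormula_mul_kronecker {V : Matrix (Fin p) (Fin p) ℝ} (hV : V.PosDef) :
    derivFormula G V * (V ⊗ₖ V) =
      symMat p * (V ⊗ₖ V - (QD G)ᵀ * (coreD G V)⁻¹ * QD G * symMat p) := by
  rw [derivFormula, Matrix.sub_mul, Matrix.mul_assoc _ (symMat p) (V ⊗ₖ V), symMat_mul_kronecker,
    ← Matrix.mul_assoc _ (V ⊗ₖ V) (symMat p), Matrix.mul_assoc _ (V⁻¹ ⊗ₖ V⁻¹) (V ⊗ₖ V),
    kronecker_inv_mul_kronecker hV, Matrix.mul_one, Matrix.mul_sub, symMat_mul_kronecker]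
  simp only [Matrix.mul_assoc]

theorem transpose_coreD_inv {V : Matrix (Fin p) (Fin p) ℝ} (hV : V.PosDef) :
    ((coreD G V)⁻¹)ᵀ = (coreD G V)⁻¹ := by
  have h := (posDef_coreD G hV).inv.1
  rwa [Matrix.IsHermitian, Matrix.conjTranspose_eq_transpose_of_trivial] at h

theorem transpose_derivFormula {V : Matrix (Fin p) (Fin p) ℝ} (hV : V.PosDef) :
    (derivFormula G V)ᵀ =
      symMat p - symMat p * (V⁻¹ ⊗ₖ V⁻¹) * (QD G)ᵀ * (coreD G V)⁻¹ * QD G * symMat p := by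
  rw [derivFormula, Matrix.transpose_sub]
  simp only [Matrix.transpose_mul, Matrix.transpose_transpose, transpose_symMat,
    transpose_coreD_inv G hV, kronecker_self_isSymm (isHermitian_iff_isSymm.1 hV.inv.1),
    Matrix.mul_assoc]

theorem transpose_derivFormula_mul_kronecker {V : Matrix (Fin p) (Fin p) ℝ} (hV : V.PosDef) :
    (derivFormula G V * (V ⊗ₖ V))ᵀ = derivFormula G V * (V ⊗ₖ V) := by
  rw [derivFormula_mul_kronecker G hV, Matrix.mul_sub, Matrix.transpose_sub, Matrix.transpose_mul,
    kronecker_self_isSymm (isHermitian_iff_isSymm.1 hV.1), transpose_symMat,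
    ← symMat_mul_kronecker]
  simp only [Matrix.transpose_mul, Matrix.transpose_transpose, transpose_symMat,
    transpose_coreD_inv G hV, Matrix.mul_assoc]

/-- By symmetry (V ⊗ V)Tᵀ = T(V ⊗ V), and T is idempotent. -/
theorem derivFormula_conj_kronecker {V : Matrix (Fin p) (Fin p) ℝ} (hV : V.PosDef) :
    derivFormula G V * (V ⊗ₖ V) * (derivFormula G V)ᵀ = derivFormula G V * (V ⊗ₖ V) := by
  have h := transpose_derivFormula_mul_kronecker G hV
  rw [Matrix.transpose_mul, kronecker_self_isSymm (isHermitian_iff_isSymm.1 hV.1)] at h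
  rw [Matrix.mul_assoc, h, ← Matrix.mul_assoc, derivFormula_mul_self G hV]

theorem WVG_of_hG_eq (s₁ s₂ : ℝ) {V : Matrix (Fin p) (Fin p) ℝ} (hV : V.PosDef)
    (h : hG G V = V) :
    WVG G s₁ s₂ V = (2 * s₁) • (symMat p * (V ⊗ₖ V -
      (QD G)ᵀ * (coreD G V)⁻¹ * QD G * symMat p)) + s₂ • vecOuter V := by
  rw [WVG, derivMat_hG G hV, h, derivFormula_conj_kronecker G hV, derivFormula_mul_kronecker G hV]

theorem QKt_apply (z : edgePos G) (w : LowerPos p) : QKt G z w = if w.1 = z.1 then 1 else 0 := by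
  obtain ⟨⟨i, j⟩, hz⟩ := z
  have hle : j ≤ i := by
    rcases (mem_edgePos G).1 hz with h | h
    · exact h.1.le
    · exact h.ge
  rw [QKt, Matrix.mul_apply, Finset.sum_eq_single ((j, i) : Coord p)]
  · simp [selMat, dupMat, max_eq_left hle, min_eq_right hle]
  · intro c _ hc
    simp [selMat, hc]
  · simp

theorem transpose_QKt_mulVec (x : edgePos G → ℝ) (w : LowerPos p) :
    ((QKt G)ᵀ *ᵥ x) w = if h : w.1 ∈ edgePos G then x ⟨w.1, h⟩ else 0 := by
  simp only [Matrix.mulVec, dotProduct, Matrix.transpose_apply, QKt_apply, ite_mul, one_mul,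
    zero_mul]
  split_ifs with h
  · rw [Finset.sum_eq_single ⟨w.1, h⟩]
    · simp
    · rintro z - hne
      exact if_neg fun h' => hne (Subtype.ext h'.symm)
    · simp
  · refine Finset.sum_eq_zero fun z _ => if_neg fun h' => h ?_
    rw [h']
    exact z.2

theorem dupMat_mul_transpose_QKt_mulVec (x : edgePos G → ℝ) (i j : Fin p) :
    ((dupMat p * (QKt G)ᵀ) *ᵥ x) (j, i) =
      if h : (max i j, min i j) ∈ edgePos G then x ⟨(max i j, min i j), h⟩ else 0 := by
  rw [← Matrix.mulVec_mulVec, dupMat_mulVec_apply, transpose_QKt_mulVec]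

theorem QK_mul_dupMat_mul_transpose_QKt : QK G * (dupMat p * (QKt G)ᵀ) = 1 := by
  refine Matrix.ext_of_mulVec_single fun w => ?_
  rw [← Matrix.mulVec_mulVec, Matrix.one_mulVec, ← vec_mat ((dupMat p * (QKt G)ᵀ) *ᵥ _)]
  ext ⟨⟨i, j⟩, hz⟩
  have hle : j ≤ i := by
    rcases (mem_edgePos G).1 hz with h | h
    · exact h.1.le
    · exact h.ge
  rw [selMat_mulVec_vec, mat, Matrix.of_apply, dupMat_mul_transpose_QKt_mulVec]
  simp [max_eq_left hle, min_eq_right hle, hz]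

theorem QD_mul_dupMat_mul_transpose_QKt : QD G * (dupMat p * (QKt G)ᵀ) = 0 := by
  refine Matrix.ext_of_mulVec_single fun w => ?_
  rw [← Matrix.mulVec_mulVec, Matrix.zero_mulVec, ← vec_mat ((dupMat p * (QKt G)ᵀ) *ᵥ _)]
  ext ⟨⟨i, j⟩, hz⟩
  have hz' := (mem_nonEdgePos G).1 hz
  have hK : (i, j) ∉ edgePos G := fun h => by
    rcases (mem_edgePos G).1 h with h | h
    · exact hz'.2 h.2
    · exact hz'.1.ne' h
  rw [selMat_mulVec_vec, mat, Matrix.of_apply, dupMat_mul_transpose_QKt_mulVec]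
  simp [max_eq_left hz'.1.le, min_eq_right hz'.1.le, hK]

/-- D_p Q̃_Kᵀ rebuilds a symmetric matrix that is zero at the non-edges from its entries in K(G). -/
theorem dupMat_mul_transpose_QKt_mul_QK_mulVec {X : Matrix (Fin p) (Fin p) ℝ} (hX : X.IsSymm)
    (hD : QD G *ᵥ Matrix.vec X = 0) :
    (dupMat p * (QKt G)ᵀ) *ᵥ (QK G *ᵥ Matrix.vec X) = Matrix.vec X := by
  ext ⟨j, i⟩
  rw [dupMat_mul_transpose_QKt_mulVec]
  have hmm : X (max i j) (min i j) = X i j := by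
    rcases le_total i j with h | h
    · rw [max_eq_right h, min_eq_left h, hX.apply]
    · rw [max_eq_left h, min_eq_right h]
  split_ifs with h
  · rw [selMat_mulVec_vec]
    exact hmm
  · change 0 = X i j
    rw [← hmm]
    refine (apply_eq_zero_of_QD G hX hD fun h' => h ?_).symm
    rw [mem_edgePos]
    rcases h' with h' | h'
    · exact Or.inl ⟨lt_of_le_of_ne min_le_max h'.ne', h'⟩
    · exact Or.inr h'

/-- With R = D_p Q̃_Kᵀ the core is Rᵀ(V ⊗ V)R. The range of WT consists of symmetric matrices with
zeros at the non-edges, so R Q_K WT = WT; its transpose, by TᵀW = WT, absorbs Rᵀ. Since Tᵀ fixes R,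
the product collapses to Q_K R = 1. -/
theorem inv_coreK_mul {V : Matrix (Fin p) (Fin p) ℝ} (hV : V.PosDef) :
    (QK G * ((V⁻¹ ⊗ₖ V⁻¹) * derivFormula G V) * (QK G)ᵀ) * coreK G V = 1 := by
  set W := V⁻¹ ⊗ₖ V⁻¹ with hW
  set T := derivFormula G V with hT
  set R := dupMat p * (QKt G)ᵀ with hR
  have hVs := isHermitian_iff_isSymm.1 hV.1
  have hWs : Wᵀ = W := kronecker_self_isSymm (isHermitian_iff_isSymm.1 hV.inv.1)
  have hcore : coreK G V = Rᵀ * (V ⊗ₖ V) * R := by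
    rw [coreK, hR, Matrix.transpose_mul, Matrix.transpose_transpose, ← Matrix.mul_assoc]
  have hTW : Tᵀ * W = W * T := by
    have h := transpose_derivFormula_mul_kronecker G hV
    rw [Matrix.transpose_mul, kronecker_self_isSymm hVs] at h
    calc Tᵀ * W = W * ((V ⊗ₖ V) * Tᵀ) * W := by
          rw [← Matrix.mul_assoc W, kronecker_inv_mul_kronecker hV, Matrix.one_mul]
      _ = W * T * ((V ⊗ₖ V) * W) := by rw [h]; simp only [Matrix.mul_assoc, hT]
      _ = W * T := by rw [kronecker_mul_kronecker_inv hV, Matrix.mul_one]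
  have hRS : R * (QK G * (W * T)) = W * T := by
    refine ext_mulVec_vec fun X => ?_
    rw [← Matrix.mulVec_mulVec, ← Matrix.mulVec_mulVec _ (QK G),
      ← vec_mat ((W * T) *ᵥ Matrix.vec X)]
    refine dupMat_mul_transpose_QKt_mul_QK_mulVec G (isSymm_of_symMat_mulVec ?_) ?_
    · rw [vec_mat, Matrix.mulVec_mulVec, ← Matrix.mul_assoc, hW, symMat_mul_kronecker,
        Matrix.mul_assoc, symMat_mul_derivFormula]
    · rw [vec_mat, Matrix.mulVec_mulVec, ← Matrix.mul_assoc,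
        QD_mul_kronecker_mul_derivFormula G hV, Matrix.zero_mulVec]
  have hSR : W * T * (QK G)ᵀ * Rᵀ = W * T := by
    have h := congrArg Matrix.transpose hRS
    rw [Matrix.transpose_mul, Matrix.transpose_mul, Matrix.transpose_mul, hWs, hTW] at h
    exact h
  have hTR : Tᵀ * R = R := by
    have hMR : symMat p * R = R := by rw [hR, ← Matrix.mul_assoc, symMat_mul_dupMat]
    rw [hT, transpose_derivFormula G hV, Matrix.sub_mul, Matrix.mul_assoc _ (symMat p) R, hMR,
      Matrix.mul_assoc _ (QD G) R, QD_mul_dupMat_mul_transpose_QKt, Matrix.mul_zero, sub_zero]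
  calc QK G * (W * T) * (QK G)ᵀ * coreK G V
      = QK G * (W * T * (QK G)ᵀ * Rᵀ) * (V ⊗ₖ V) * R := by
        rw [hcore]; simp only [Matrix.mul_assoc]
    _ = QK G * (Tᵀ * (W * (V ⊗ₖ V)) * R) := by
        rw [hSR, ← hTW]; simp only [Matrix.mul_assoc]
    _ = 1 := by
        rw [kronecker_inv_mul_kronecker hV, Matrix.mul_one, hTR, QK_mul_dupMat_mul_transpose_QKt]

theorem isUnit_coreK {V : Matrix (Fin p) (Fin p) ℝ} (hV : V.PosDef) : IsUnit (coreK G V) :=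
  IsUnit.of_mul_eq_one_right _ (inv_coreK_mul G hV)

/-- The derivative of A ↦ Q_K vec(h_G(A)⁻¹) at V is −Q_K W T, and it sends vec V to −u; the sign
cancels in the congruence. -/
theorem WuG_eq_conj_WV (s₁ s₂ : ℝ) {V : Matrix (Fin p) (Fin p) ℝ} (hV : V.PosDef)
    (h : hG G V = V) :
    WuG G s₁ s₂ V = (-(QK G * (V⁻¹ ⊗ₖ V⁻¹) * derivFormula G V)) * WV s₁ s₂ V *
      (-(QK G * (V⁻¹ ⊗ₖ V⁻¹) * derivFormula G V))ᵀ := by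
  have hu := isUnit_det_of_posDef hV
  have hs : (V⁻¹).IsSymm := isHermitian_iff_isSymm.1 hV.inv.1
  have hv : derivFormula G V *ᵥ Matrix.vec V = Matrix.vec V := by
    have := derivFormula_mulVec_vec G hV
    rwa [h] at this
  have huv : (QK G * (V⁻¹ ⊗ₖ V⁻¹) * derivFormula G V) *ᵥ Matrix.vec V = (uVec G V⁻¹).ofLp := by
    rw [← Matrix.mulVec_mulVec, hv, ← Matrix.mulVec_mulVec, kronecker_self_mulVec_vec hs,
      Matrix.nonsing_inv_mul _ hu, Matrix.one_mul]
    rfl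
  have hK : QK G * (V⁻¹ ⊗ₖ V⁻¹) * derivFormula G V * (V ⊗ₖ V) *
      (QK G * (V⁻¹ ⊗ₖ V⁻¹) * derivFormula G V)ᵀ = (coreK G V)⁻¹ := by
    rw [Matrix.inv_eq_left_inv (inv_coreK_mul G hV), Matrix.transpose_mul, Matrix.transpose_mul,
      kronecker_self_isSymm hs]
    calc _ = QK G * (V⁻¹ ⊗ₖ V⁻¹) * (derivFormula G V * (V ⊗ₖ V) * (derivFormula G V)ᵀ) *
          (V⁻¹ ⊗ₖ V⁻¹) * (QK G)ᵀ := by simp only [Matrix.mul_assoc]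
      _ = QK G * ((V⁻¹ ⊗ₖ V⁻¹) * derivFormula G V) * ((V ⊗ₖ V) * (V⁻¹ ⊗ₖ V⁻¹)) * (QK G)ᵀ := by
          rw [derivFormula_conj_kronecker G hV]; simp only [Matrix.mul_assoc]
      _ = _ := by rw [kronecker_mul_kronecker_inv hV, Matrix.mul_one]
  rw [Matrix.neg_mul, Matrix.transpose_neg, Matrix.neg_mul, Matrix.mul_neg, neg_neg,
    conj_WV s₁ s₂ V (by rw [Matrix.mul_assoc, derivFormula_mul_symMat]), huv, hK, WuG]

end Covariance

/-! ### Convergence in distribution and the delta method -/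

section Probability

theorem aemeasurable_of_sqrt_smul_sub {Ω E : Type*} [MeasurableSpace Ω] {P : Measure Ω}
    [NormedAddCommGroup E] [MeasurableSpace E] [BorelSpace E] [NormedSpace ℝ E]
    {X : ℕ → Ω → E} {θ : E} {n : ℕ} (hn : n ≠ 0)
    (h : AEMeasurable (fun ω => Real.sqrt n • (X n ω - θ)) P) : AEMeasurable (X n) P := by
  have hs : Real.sqrt n ≠ 0 := Real.sqrt_ne_zero'.2 (Nat.cast_pos.2 (Nat.pos_of_ne_zero hn))
  have h' := (h.const_smul (Real.sqrt n)⁻¹).add_const θ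
  refine h'.congr (Eventually.of_forall fun ω => ?_)
  simp [smul_smul, hs]

variable {Ω Ω' E F : Type*} [MeasurableSpace Ω] [MeasurableSpace Ω']
  {P : Measure Ω} [IsProbabilityMeasure P] {P' : Measure Ω'} [IsProbabilityMeasure P']
  [NormedAddCommGroup E] [MeasurableSpace E] [BorelSpace E]
  [NormedAddCommGroup F] [MeasurableSpace F] [BorelSpace F]

/-- A sequence that converges in distribution is bounded in probability. -/
theorem exists_eventually_measure_norm_ge_lt {Y : ℕ → Ω → E} {Z : Ω' → E}
    (h : TendstoInDistribution Y atTop Z (fun _ => P) P') {δ : ENNReal} (hδ : 0 < δ) :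
    ∃ K : ℝ, 0 < K ∧ ∀ᶠ n in atTop, P {ω | K ≤ ‖Y n ω‖} < δ := by
  have hZ := h.aemeasurable_limit
  have hclosed : ∀ K : ℝ, IsClosed {x : E | K ≤ ‖x‖} := fun K =>
    isClosed_le continuous_const continuous_norm
  have : IsProbabilityMeasure (P'.map Z) := Measure.isProbabilityMeasure_map hZ
  have hlim : Tendsto (P'.map Z ∘ fun k : ℕ => {x : E | (k : ℝ) ≤ ‖x‖}) atTop (𝓝 0) := by
    have hempty : (⋂ k : ℕ, {x : E | (k : ℝ) ≤ ‖x‖}) = ∅ := by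
      refine Set.eq_empty_iff_forall_notMem.2 fun x hx => ?_
      obtain ⟨k, hk⟩ := exists_nat_gt ‖x‖
      exact absurd (Set.mem_iInter.1 hx k) (not_le.2 hk)
    have := tendsto_measure_iInter_atTop (μ := P'.map Z)
      (s := fun k : ℕ => {x : E | (k : ℝ) ≤ ‖x‖})
      (fun k => (hclosed k).measurableSet.nullMeasurableSet)
      (fun a b hab x (hx : (b : ℝ) ≤ ‖x‖) => (Nat.cast_le (α := ℝ).2 hab).trans hx)
      ⟨0, measure_ne_top _ _⟩
    rwa [hempty, measure_empty] at this
  obtain ⟨k, hk, hk0⟩ := ((hlim.eventually_lt_const hδ).and (eventually_gt_atTop 0)).exists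
  refine ⟨k, Nat.cast_pos.2 hk0, ?_⟩
  -- Portmanteau for closed sets: the limsup is at most the limit's tail mass, chosen below δ.
  have hls := ProbabilityMeasure.limsup_measure_closed_le_of_tendsto h.tendsto (hclosed k)
  filter_upwards [eventually_lt_of_limsup_lt (hls.trans_lt hk)] with n hn
  have hmap : P.map (Y n) {x : E | (k : ℝ) ≤ ‖x‖} < δ := hn
  rwa [Measure.map_apply_of_aemeasurable (h.forall_aemeasurable n)
    (hclosed k).measurableSet] at hmap

/-- A limit in distribution may be replaced by its law. -/
theorem tendstoInDistribution_id_of_hasLaw {X : ℕ → Ω → E} {Z : Ω' → E} {μ : Measure E}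
    [IsProbabilityMeasure μ] (h : TendstoInDistribution X atTop Z (fun _ => P) P')
    (hZ : HasLaw Z μ P') : TendstoInDistribution X atTop id (fun _ => P) μ := by
  refine ⟨h.forall_aemeasurable, aemeasurable_id, ?_⟩
  have heq : (⟨P'.map Z, Measure.isProbabilityMeasure_map h.aemeasurable_limit⟩ :
      ProbabilityMeasure E) = ⟨μ.map id, Measure.isProbabilityMeasure_map aemeasurable_id⟩ :=
    Subtype.ext (hZ.map_eq.trans Measure.map_id.symm)
  exact heq ▸ h.tendsto

variable [NormedSpace ℝ E] [NormedSpace ℝ F] [SecondCountableTopology F]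

/-- The **delta method**, for a function that is differentiable within a set which contains the
estimators with probability tending to one. -/
theorem delta_method {X : ℕ → Ω → E} {θ : E} {Z : Ω' → E}
    (h : TendstoInDistribution (fun (n : ℕ) ω => Real.sqrt n • (X n ω - θ)) atTop Z
      (fun _ => P) P')
    {f : E → F} (hfm : Measurable f) {f' : E →L[ℝ] F} {S : Set E} (hS : MeasurableSet S)
    (hf : HasFDerivWithinAt f f' S θ)
    (hXS : Tendsto (fun n => P {ω | X n ω ∈ S}) atTop (𝓝 1)) :
    TendstoInDistribution (fun (n : ℕ) ω => Real.sqrt n • (f (X n ω) - f θ)) atTop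
      (fun ω' => f' (Z ω')) (fun _ => P) P' := by
  have hX : ∀ n ≠ 0, AEMeasurable (X n) P := fun n hn =>
    aemeasurable_of_sqrt_smul_sub hn (h.forall_aemeasurable n)
  -- Slutsky: the linearized sequence converges by continuous mapping, so it suffices that the
  -- remainder tends to 0 in probability.
  refine tendstoInDistribution_of_tendstoInMeasure_sub
    (X := fun (n : ℕ) ω => f' (Real.sqrt n • (X n ω - θ))) _ _
    (h.continuous_comp f'.continuous) ?_ fun n => ?_
  swap
  -- At n = 0 the scaling is zero, so the hypothesis says nothing about the measurability of X 0,
  -- and nothing is needed.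
  · rcases eq_or_ne n 0 with rfl | hn
    · simp
    · exact ((hfm.comp_aemeasurable (hX n hn)).sub_const _).const_smul _
  rw [tendstoInMeasure_iff_norm]
  intro ε hε
  rw [ENNReal.tendsto_nhds_zero]
  intro δ hδ
  have hδ2 : 0 < δ / 2 := ENNReal.half_pos hδ.ne'
  obtain ⟨K, hK, hKev⟩ := exists_eventually_measure_norm_ge_lt h hδ2
  have hcompl : Tendsto (fun n => 1 - P {ω | X n ω ∈ S}) atTop (𝓝 0) := by
    have := ENNReal.Tendsto.sub (tendsto_const_nhds (x := (1 : ENNReal)) (f := atTop)) hXS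
      (Or.inl ENNReal.one_ne_top)
    rwa [tsub_self] at this
  -- Slope ε / K: when the scaled error is below K and √n > K / η, the estimator is within η of θ
  -- and the scaled remainder is below ε.
  obtain ⟨η, hη, hball⟩ := Metric.eventually_nhds_iff.1
    (eventually_nhdsWithin_iff.1 (hf.isLittleO.def (div_pos hε hK)))
  have hsqrt : Tendsto (fun n : ℕ => Real.sqrt n) atTop atTop :=
    Real.tendsto_sqrt_atTop.comp tendsto_natCast_atTop_atTop
  filter_upwards [hKev, hcompl.eventually_lt_const hδ2, hsqrt.eventually_gt_atTop (K / η),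
    eventually_ne_atTop 0] with n h1 h2 h3 h4
  have hsub : {ω | ε ≤ ‖((fun (n : ℕ) ω => Real.sqrt n • (f (X n ω) - f θ)) -
      fun (n : ℕ) ω => f' (Real.sqrt n • (X n ω - θ))) n ω - (0 : Ω → F) ω‖} ⊆
      {ω | X n ω ∈ S}ᶜ ∪ {ω | K ≤ ‖Real.sqrt n • (X n ω - θ)‖} := by
    intro ω hω
    by_contra hnot
    rw [Set.mem_union, not_or, Set.notMem_compl_iff] at hnot
    obtain ⟨hωS, hωK⟩ := hnot
    replace hωK : ‖Real.sqrt n • (X n ω - θ)‖ < K := not_le.1 hωK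
    have hs0 : 0 < Real.sqrt n := (div_pos hK hη).trans h3
    rw [norm_smul, Real.norm_of_nonneg hs0.le] at hωK
    have hdist : dist (X n ω) θ < η := by
      rw [dist_eq_norm]
      rw [div_lt_iff₀ hη] at h3
      exact lt_of_mul_lt_mul_left (hωK.trans h3) hs0.le
    have hb := hball hdist hωS
    have hω' : ε ≤ ‖Real.sqrt n • (f (X n ω) - f θ) - f' (Real.sqrt n • (X n ω - θ))‖ := by
      simpa using hω
    rw [map_smul, ← smul_sub, norm_smul, Real.norm_of_nonneg hs0.le] at hω'
    have := calc
      ε ≤ Real.sqrt n * ‖f (X n ω) - f θ - f' (X n ω - θ)‖ := hω'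
      _ ≤ Real.sqrt n * (ε / K * ‖X n ω - θ‖) := mul_le_mul_of_nonneg_left hb hs0.le
      _ = ε / K * (Real.sqrt n * ‖X n ω - θ‖) := by ring
      _ < ε / K * K := mul_lt_mul_of_pos_left hωK (div_pos hε hK)
      _ = ε := div_mul_cancel₀ _ hK.ne'
    exact lt_irrefl _ this
  have hnull : NullMeasurableSet {ω | X n ω ∈ S} P := (hX n h4).nullMeasurableSet_preimage hS
  calc _ ≤ P ({ω | X n ω ∈ S}ᶜ ∪ {ω | K ≤ ‖Real.sqrt n • (X n ω - θ)‖}) := measure_mono hsub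
    _ ≤ P {ω | X n ω ∈ S}ᶜ + P {ω | K ≤ ‖Real.sqrt n • (X n ω - θ)‖} := measure_union_le _ _
    _ ≤ δ / 2 + δ / 2 := by
        rw [prob_compl_eq_one_sub₀ hnull]
        exact add_le_add h2.le h1.le
    _ = δ := ENNReal.add_halves δ

end Probability

/-! ### Linear images of centered normal laws -/

section Gaussian

variable {ι κ : Type*} [Fintype ι] [Fintype κ]

theorem adjoint_actL (L : Matrix ι κ ℝ) : (actL L).adjoint = actL Lᵀ := by
  refine ((ContinuousLinearMap.eq_adjoint_iff _ _).2 fun x y => ?_).symm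
  simp only [actL_apply, act, EuclideanSpace.inner_eq_star_dotProduct, star_trivial]
  rw [Matrix.mulVec_transpose, dotProduct_comm, ← Matrix.dotProduct_mulVec, dotProduct_comm]

variable [DecidableEq ι] [DecidableEq κ]

/-- The image of a centered normal distribution under a linear map. -/
theorem multivariateGaussian_map_actL {S : Matrix κ κ ℝ} (hS : S.PosSemidef) (L : Matrix ι κ ℝ) :
    (multivariateGaussian 0 S).map (actL L) = multivariateGaussian 0 (L * S * Lᵀ) := by
  -- A Gaussian measure is determined by its mean and covariance form.
  apply IsGaussian.ext
  · simp only [id_eq, integral_id_multivariateGaussian]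
    rw [ContinuousLinearMap.integral_id_map IsGaussian.integrable_id,
      integral_id_multivariateGaussian, map_zero]
  · ext x y
    rw [covarianceBilin_map IsGaussian.memLp_two_id, covarianceBilin_multivariateGaussian hS,
      covarianceBilin_multivariateGaussian (posSemidef_conj hS L), adjoint_actL]
    simp only [actL_apply, act]
    rw [← Matrix.mulVec_mulVec, ← Matrix.mulVec_mulVec, Matrix.dotProduct_mulVec _ L,
      Matrix.mulVec_transpose]

theorem hasLaw_act_multivariateGaussian {Ω' : Type*} [MeasurableSpace Ω'] {P' : Measure Ω'}
    {S : Matrix κ κ ℝ} (hS : S.PosSemidef) {Z : Ω' → EuclideanSpace ℝ κ}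
    (hZ : HasLaw Z (multivariateGaussian 0 S) P') (L : Matrix ι κ ℝ) :
    HasLaw (fun ω' => act L (Z ω')) (multivariateGaussian 0 (L * S * Lᵀ)) P' :=
  HasLaw.fun_comp ⟨(actL L).continuous.aemeasurable, multivariateGaussian_map_actL hS L⟩ hZ

end Gaussian

/-! ### Measurability, and the derivative of the concentration entries -/

section Measurability

variable (G : SimpleGraph (Fin p)) [DecidableRel G.Adj]

/-- h_G is continuous on the measurable set of positive definite matrices and constant off it. -/
theorem measurable_hGvec : Measurable (hGvec G) := by
  classical
  set s : Set (EuclideanSpace ℝ (Coord p)) :=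
    symSet p ∩ (fun x => mat x.ofLp) ⁻¹' posForm p with hs
  have hpd : ∀ x, x ∈ s ↔ (mat x.ofLp).PosDef := fun x =>
    posDef_iff_isSymm_and_mem_posForm.symm
  have hmeas : MeasurableSet s :=
    isClosed_symSet.measurableSet.inter (isOpen_posForm.preimage continuous_mat).measurableSet
  have hcont : ContinuousOn (hGvec G) s := fun x hx =>
    (hasFDerivWithinAt_hGvec G ((hpd x).1 hx)).continuousWithinAt.mono Set.inter_subset_left
  have heq : hGvec G = s.piecewise (hGvec G) fun _ => evec 0 := by
    funext x
    by_cases hx : x ∈ s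
    · rw [Set.piecewise_eq_of_mem _ _ _ hx]
    · rw [Set.piecewise_eq_of_notMem _ _ _ hx, hGvec,
        hG_of_not_posDef G fun h => hx ((hpd x).2 h)]
  rw [heq]
  exact hcont.measurable_piecewise continuousOn_const hmeas

/-- The quotient of adjugate and determinant is valid everywhere, because singular inverses and 0⁻¹
are both 0. -/
theorem measurable_evec_inv :
    Measurable fun x : EuclideanSpace ℝ (Coord p) => evec (mat x.ofLp)⁻¹ := by
  have h : (fun x : EuclideanSpace ℝ (Coord p) => evec (mat x.ofLp)⁻¹) =
      fun x => (mat x.ofLp).det⁻¹ • evec (mat x.ofLp).adjugate := by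
    funext x
    rw [Matrix.inv_def, Ring.inverse_eq_inv']
    rfl
  rw [h]
  exact continuous_mat.matrix_det.measurable.inv.smul
    (continuous_evec.comp continuous_mat.matrix_adjugate).measurable

/-- `Q_K vec (h_G(A)⁻¹)` as a function of `vec A`. -/
def uVecFun (x : EuclideanSpace ℝ (Coord p)) : EuclideanSpace ℝ (edgePos G) :=
  uVec G (hG G (mat x.ofLp))⁻¹

theorem measurable_uVecFun : Measurable (uVecFun G) :=
  (actL (QK G)).continuous.measurable.comp (measurable_evec_inv.comp (measurable_hGvec G))

theorem hasFDerivWithinAt_uVecFun {V : Matrix (Fin p) (Fin p) ℝ} (hV : V.PosDef) :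
    HasFDerivWithinAt (uVecFun G) (actL (-(QK G * ((hG G V)⁻¹ ⊗ₖ (hG G V)⁻¹) *
      derivFormula G (hG G V)))) (symSet p) (evec V) := by
  have h1 := hasFDerivWithinAt_hGvec G hV
  have h2 : HasFDerivAt (fun x : EuclideanSpace ℝ (Coord p) => evec (mat x.ofLp)⁻¹) _
      (hGvec G (evec V)) := (hasStrictFDerivAt_evec_inv (isConstrained_hG G hV).1).hasFDerivAt
  have h3 := (actL (QK G)).hasFDerivAt.comp_hasFDerivWithinAt (evec V)
    (h2.comp_hasFDerivWithinAt (evec V) h1)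
  refine h3.congr_fderiv ?_
  rw [ContinuousLinearMap.neg_comp, ContinuousLinearMap.comp_neg, actL_comp, actL_comp, actL_neg,
    Matrix.mul_assoc]

end Measurability

end EllGraph

end

theorem theorem1 {p : ℕ} (G : SimpleGraph (Fin p)) [DecidableRel G.Adj]
    {Ω Ω' : Type*} [MeasurableSpace Ω] [MeasurableSpace Ω']
    (P : Measure Ω) [IsProbabilityMeasure P] (P' : Measure Ω') [IsProbabilityMeasure P']
    (V : Matrix (Fin p) (Fin p) ℝ) (hV : V.PosDef)
    (Vhat : ℕ → Ω → Matrix (Fin p) (Fin p) ℝ)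
    (hsymm : Tendsto (fun n => P {ω | (Vhat n ω).IsSymm}) atTop (𝓝 1))
    (Z : Ω' → EuclideanSpace ℝ (EllGraph.Coord p))
    (hconv : TendstoInDistribution
      (fun (n : ℕ) ω => Real.sqrt n • EllGraph.evec (Vhat n ω - V)) atTop Z (fun _ => P) P') :
    (∀ A : Matrix (Fin p) (Fin p) ℝ, A.PosDef →
      (∃! B, EllGraph.IsConstrained G A B) ∧ EllGraph.IsConstrained G A (EllGraph.hG G A)) ∧
    DifferentiableAt ℝ (EllGraph.tildeFun (EllGraph.hG G)) (EllGraph.vech V) ∧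
    IsUnit (EllGraph.coreD G (EllGraph.hG G V)) ∧
    EllGraph.derivMat (EllGraph.hG G) V =
      EllGraph.symMat p - EllGraph.symMat p * (EllGraph.QD G)ᵀ *
        (EllGraph.coreD G (EllGraph.hG G V))⁻¹ * EllGraph.QD G *
        ((EllGraph.hG G V)⁻¹ ⊗ₖ (EllGraph.hG G V)⁻¹) * EllGraph.symMat p ∧
    TendstoInDistribution
      (fun (n : ℕ) ω => Real.sqrt n • EllGraph.evec (EllGraph.hG G (Vhat n ω) - EllGraph.hG G V))
      atTop (fun ω' => EllGraph.act (EllGraph.derivMat (EllGraph.hG G) V) (Z ω'))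
      (fun _ => P) P' ∧
    (V⁻¹ ∈ EllGraph.concSet G ↔ EllGraph.hG G V = V) ∧
    ∀ s₁ s₂ : ℝ, 0 ≤ s₁ → -(2 * s₁ / p) ≤ s₂ →
      HasLaw Z (multivariateGaussian 0 (EllGraph.WV s₁ s₂ V)) P' →
      ((EllGraph.WVG G s₁ s₂ V).PosSemidef ∧
        HasLaw (fun ω' => EllGraph.act (EllGraph.derivMat (EllGraph.hG G) V) (Z ω'))
          (multivariateGaussian 0 (EllGraph.WVG G s₁ s₂ V)) P') ∧
      (V⁻¹ ∈ EllGraph.concSet G →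
        (IsUnit (EllGraph.coreD G V) ∧
          EllGraph.WVG G s₁ s₂ V =
            (2 * s₁) • (EllGraph.symMat p * (V ⊗ₖ V -
              (EllGraph.QD G)ᵀ * (EllGraph.coreD G V)⁻¹ * EllGraph.QD G * EllGraph.symMat p)) +
            s₂ • EllGraph.vecOuter V) ∧
        (IsUnit (EllGraph.coreK G V) ∧ (EllGraph.WuG G s₁ s₂ V).PosSemidef ∧
          TendstoInDistribution
            (fun (n : ℕ) ω => Real.sqrt n •
              (EllGraph.uVec G (EllGraph.hG G (Vhat n ω))⁻¹ - EllGraph.uVec G V⁻¹))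
            atTop id (fun _ => P) (multivariateGaussian 0 (EllGraph.WuG G s₁ s₂ V)))) := by
  have hderiv := EllGraph.derivMat_hG G hV
  have hXS : Tendsto (fun n => P {ω | EllGraph.evec (Vhat n ω) ∈ EllGraph.symSet p}) atTop (𝓝 1) :=
    hsymm
  have hS := EllGraph.isClosed_symSet (p := p) |>.measurableSet
  have hconv' : TendstoInDistribution
      (fun (n : ℕ) ω => Real.sqrt n • (EllGraph.evec (Vhat n ω) - EllGraph.evec V)) atTop Z
      (fun _ => P) P' := hconv
  refine ⟨fun A hA => ⟨⟨EllGraph.hG G A, EllGraph.isConstrained_hG G hA, fun B hB =>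
      hB.unique (EllGraph.isConstrained_hG G hA)⟩, EllGraph.isConstrained_hG G hA⟩,
    (EllGraph.hasFDerivAt_tildeFun_hG G hV).differentiableAt,
    EllGraph.isUnit_coreD G (EllGraph.isConstrained_hG G hV).1, hderiv, ?_,
    EllGraph.inv_mem_concSet_iff G hV, ?_⟩
  · rw [hderiv]
    exact EllGraph.delta_method hconv' (EllGraph.measurable_hGvec G) hS
      (EllGraph.hasFDerivWithinAt_hGvec G hV) hXS
  intro s₁ s₂ h₁ h₂ hZ
  have hW := EllGraph.posSemidef_WV h₁ h₂ hV
  refine ⟨?_, fun hconc => ?_⟩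
  · rw [EllGraph.WVG_eq_conj_WV G s₁ s₂ hV]
    exact ⟨EllGraph.posSemidef_conj hW _, EllGraph.hasLaw_act_multivariateGaussian hW hZ _⟩
  have hfix := (EllGraph.inv_mem_concSet_iff G hV).1 hconc
  have hWu := EllGraph.WuG_eq_conj_WV G s₁ s₂ hV hfix
  refine ⟨⟨EllGraph.isUnit_coreD G hV, EllGraph.WVG_of_hG_eq G s₁ s₂ hV hfix⟩,
    EllGraph.isUnit_coreK G hV, ?_, ?_⟩
  · rw [hWu]
    exact EllGraph.posSemidef_conj hW _
  have hu := EllGraph.delta_method hconv' (EllGraph.measurable_uVecFun G) hS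
    (EllGraph.hasFDerivWithinAt_uVecFun G hV) hXS
  rw [hfix] at hu
  -- The linear image of Z has the law N(0, `WuG`), so the limit variable may be replaced by that
  -- law.
  have hlaw := EllGraph.hasLaw_act_multivariateGaussian hW hZ
    (-(EllGraph.QK G * (V⁻¹ ⊗ₖ V⁻¹) * EllGraph.derivFormula G V))
  rw [← hWu] at hlaw
  have hval : EllGraph.uVecFun G (EllGraph.evec V) = EllGraph.uVec G V⁻¹ := by
    rw [EllGraph.uVecFun, EllGraph.mat_evec, hfix]
  rw [hval] at hu
  exact EllGraph.tendstoInDistribution_id_of_hasLaw hu hlaw
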